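/- Let $\mathbb D$ be the open unit disc and $H^\infty$ the space of bounded analytic functions on $\mathbb D$ with norm $\|h\|=\sup_{z\in\mathbb D}|h(z)|$, regarded as the dual of $L^1(\mathbb T)/H^1_0$ through $\langle f,h\rangle=\int_{\mathbb T} f h\,dm$ ($m$ is normalized Lebesgue measure on the unit circle $\mathbb T$, and $h$ is extended to $\mathbb T$ by its boundary values); its weak* topology is the coarsest one making all $h\mapsto\langle f,h\rangle$, $f\in L^1(\mathbb T)$, continuous. Give $\ell^\infty=(\ell^1)^*$ its weak* topology. For a weak*-closed subspace $E\subset H^\infty$ let $\mathcal Q_E$ be its predual, i.e. the Banach space of weak*-continuous linear functionals on $E$. Let $\epsilon_n$ denote the $n$-th unit sequence. An $\ell^1$-basis of a Banach space $X$ is a Schauder basis $(x_n)$ for which there is a linear homeomorphism $A:\ell^1\to X$ with $A\epsilon_n=x_n$ for all $n$. An $\ell^\infty$-basis of $E$ is a sequence $(x_n)$ in $E$ such that every $x\in E$ has a unique weak*-convergent expansion $x=\sum_n\alpha_n x_n$ with complex coefficients, and there is a linear weak*-homeomorphism $A:\ell^\infty\to E$ with $A\epsilon_n=x_n$ for all $n$.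 Let $(b_n)_{n\in\mathbb N}$ be an interpolating sequence in $\mathbb D$, i.e. the map $\mathcal J:H^\infty\to\ell^\infty$, $\mathcal J(h)=(h(b_n))_n$, is onto. (1) Let $(\beta_n)_{n\in\mathbb N}$ be a sequence in $H^\infty$ and $M$ a real number such that $\beta_k(b_j)=\delta_{kj}$ for all $j,k$ and $\sup_{z\in\mathbb D}\sum_n|\beta_n(z)|\le M$. Then $T(c)=\sum_n c_n\beta_n$ (the series converging absolutely at each point of $\mathbb D$, and in the weak* topology) defines a linear map which is both a norm-homeomorphism and a weak*-homeomorphism of $\ell^\infty$ onto $E:=T(\ell^\infty)$, and $E$ is weak*-closed in $H^\infty$. Its inverse is $\mathcal J|_E$, and $\|T\|\le M$, $\|T^{-1}\|\le 1$. The evaluations $E_{b_n}:h\mapsto h(b_n)$ $(h \in E)$ belong to $\mathcal Q_E$ and form an $\ell^1$-basis of $\mathcal Q_E$, and $(\beta_n)$ is an $\ell^\infty$-basis of $E$. (2) Such functions exist: let $M_0$ be the interpolation constant of $(b_n)$, i.e. the infimum of all $C\ge 0$ such that every $c\in\ell^\infty$ equals $\mathcal J(h)$ for some $h\in H^\infty$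 with $\|h\|\le C\|c\|_\infty$. Then there is a sequence $(\beta_n)$ in $H^\infty$ with $\beta_k(b_j)=\delta_{kj}$ for all $j,k$ and $\sup_{z\in\mathbb D}\sum_n|\beta_n(z)|\le M_0^2$. -/

import Mathlib

open Filter Topology Metric Real
open scoped BoundedContinuousFunction ENNReal lp

noncomputable section

/-- The open unit disc `𝔻` of `ℂ`, as a type. -/
abbrev UDisc : Type := Metric.ball (0 : ℂ) 1

/-- A function on the open unit disc, extended by `0` to all of `ℂ`. -/
def discExt (f : UDisc → ℂ) (z : ℂ) : ℂ :=
  open Classical in if hz : z ∈ Metric.ball (0 : ℂ) 1 then f ⟨z, hz⟩ else 0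

/-- The bounded analytic functions in the open unit disc, as a subspace of the space of bounded
continuous functions on `𝔻` with the norm `‖h‖ = sup_{z ∈ 𝔻} |h z|`. -/
def hinfSubmodule : Submodule ℂ (UDisc →ᵇ ℂ) where
  carrier := {f | DifferentiableOn ℂ (discExt f) (Metric.ball (0 : ℂ) 1)}
  add_mem' := by
    intro f g hf hg
    refine (hf.add hg).congr ?_
    intro z hz
    rw [Pi.add_apply]
    simp only [discExt, dif_pos hz]
    rfl
  zero_mem' := by
    refine (differentiableOn_const (0 : ℂ)).congr ?_
    intro z hz
    simp only [discExt, dif_pos hz]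
    rfl
  smul_mem' := by
    intro c f hf
    refine (hf.const_smul c).congr ?_
    intro z hz
    rw [Pi.smul_apply]
    simp only [discExt, dif_pos hz]
    rfl

/-- The space `H^∞` of bounded analytic functions in the open unit disc, with the supremum norm. -/
def Hinf : Type := hinfSubmodule

instance : NormedAddCommGroup Hinf := inferInstanceAs (NormedAddCommGroup hinfSubmodule)

instance : NormedSpace ℂ Hinf := inferInstanceAs (NormedSpace ℂ hinfSubmodule)

/-- The bounded continuous function on `𝔻` underlying `h ∈ H^∞`. -/
def Hinf.toBCF (h : Hinf) : UDisc →ᵇ ℂ := Subtype.val (p := (· ∈ hinfSubmodule)) h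

/-- The value `h(z)` of `h ∈ H^∞` at a point `z` of the disc. -/
def Hinf.val (h : Hinf) (z : UDisc) : ℂ := h.toBCF z

/-- The sequence space `ℓ^1` (complex sequences indexed by `ℕ`). -/
abbrev Seq1 : Type := lp (fun _ : ℕ => ℂ) 1

/-- The sequence space `ℓ^∞` (complex sequences indexed by `ℕ`). -/
abbrev SeqInf : Type := lp (fun _ : ℕ => ℂ) ∞

/-- The duality pairing `⟨f, h⟩ = ∫_𝕋 f h dm` (`m` the normalized Lebesgue measure on the unit
circle `𝕋`) between `f ∈ L^1(𝕋)` and `h ∈ H^∞`.  The function `h` acts on the circle through its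
boundary function, the limit of the dilations `h_r(w) = h(r w)` as `r ↑ 1`. These converge
boundedly and almost everywhere on `𝕋`, so that `∫ f h dm = lim_{r ↑ 1} ∫ f h_r dm`. -/
def pairing (f : ℂ → ℂ) (h : Hinf) : ℂ :=
  limUnder (𝓝[<] (1 : ℝ)) fun r : ℝ =>
    circleAverage (fun w : ℂ => f w * discExt h.val ((r : ℂ) * w)) 0 1

/-- The weak* topology of `H^∞ = (L^1(𝕋)/H^1_0)^*`: the coarsest topology for which all the
functionals `h ↦ ⟨f, h⟩`, with `f` integrable on the unit circle, are continuous. -/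
@[reducible]
def weakStarHinf : TopologicalSpace Hinf :=
  ⨅ f : {f : ℂ → ℂ // CircleIntegrable f 0 1},
    TopologicalSpace.induced (pairing f.1) inferInstance

/-- The weak* topology of a subspace `E` of `H^∞`. -/
@[reducible]
def weakStarOn (E : Submodule ℂ Hinf) : TopologicalSpace E :=
  TopologicalSpace.induced (Subtype.val : E → Hinf) weakStarHinf

/-- The weak* topology of `ℓ^∞ = (ℓ^1)^*`. -/
@[reducible]
def weakStarSeq : TopologicalSpace SeqInf :=
  ⨅ a : Seq1, TopologicalSpace.induced (fun c : SeqInf => ∑' n, a n * c n) inferInstance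

/-- For a normed space `X` and a map `ι : X → H^∞`, the bounded linear functionals on `X` which are
continuous for the topology that `ι` pulls back from the weak* topology of `H^∞`. -/
def predualSubmodule (X : Type) [NormedAddCommGroup X] [NormedSpace ℂ X] (ι : X → Hinf) :
    Submodule ℂ (StrongDual ℂ X) where
  carrier := {φ | @Continuous X ℂ (weakStarHinf.induced ι) inferInstance φ}
  add_mem' := by
    intro φ ψ hφ hψ
    exact @Continuous.add ℂ _ _ _ X (weakStarHinf.induced ι) (fun x => φ x) (fun x => ψ x) hφ hψ
  zero_mem' := @continuous_const X ℂ (weakStarHinf.induced ι) _ 0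
  smul_mem' := by
    intro c φ hφ
    exact @Continuous.mul ℂ _ _ _ X (weakStarHinf.induced ι) (fun _ => c) (fun x => φ x)
      (@continuous_const X ℂ (weakStarHinf.induced ι) _ c) hφ

/-- The space of functionals `predualSubmodule X ι`, with the norm of the dual space of `X`. -/
def PredualOf (X : Type) [NormedAddCommGroup X] [NormedSpace ℂ X] (ι : X → Hinf) : Type :=
  predualSubmodule X ι

instance (X : Type) [NormedAddCommGroup X] [NormedSpace ℂ X] (ι : X → Hinf) :
    NormedAddCommGroup (PredualOf X ι) :=
  inferInstanceAs (NormedAddCommGroup (predualSubmodule X ι))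

instance (X : Type) [NormedAddCommGroup X] [NormedSpace ℂ X] (ι : X → Hinf) :
    NormedSpace ℂ (PredualOf X ι) :=
  inferInstanceAs (NormedSpace ℂ (predualSubmodule X ι))

/-- The functional underlying an element of `PredualOf X ι`. -/
def PredualOf.toDual {X : Type} [NormedAddCommGroup X] [NormedSpace ℂ X] {ι : X → Hinf}
    (L : PredualOf X ι) : StrongDual ℂ X :=
  Subtype.val (p := (· ∈ predualSubmodule X ι)) L

/-- The predual `𝒬_E` of a weak*-closed subspace `E` of `H^∞`: all weak*-continuous linear
functionals on `E`, with the norm of the dual space of `E`. (It is isometric to the quotient of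
`L^1(𝕋)` by the annihilator of `E`.) -/
abbrev Predual (E : Submodule ℂ Hinf) : Type := PredualOf E Subtype.val

/-- The pairing `⟨L, x⟩` of `L ∈ 𝒬_E` and `x ∈ E`. -/
def Predual.apply {E : Submodule ℂ Hinf} (L : Predual E) (x : E) : ℂ := L.toDual x

/-- `A : ℓ^∞ → E` is a weak*-homeomorphism of `ℓ^∞` onto `E`, with inverse `B`. -/
def IsWeakStarHomeo {E : Submodule ℂ Hinf} (A : SeqInf → E) (B : E → SeqInf) : Prop :=
  Function.LeftInverse B A ∧ Function.RightInverse B A ∧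
    @Continuous SeqInf E weakStarSeq (weakStarOn E) A ∧
    @Continuous E SeqInf (weakStarOn E) weakStarSeq B

/-- An `ℓ^1`-basis of a Banach space `X`: a Schauder basis equivalent to the canonical basis
`(ε_n)` of `ℓ^1`. -/
def IsSeq1Basis {X : Type*} [NormedAddCommGroup X] [NormedSpace ℂ X] (x : ℕ → X) : Prop :=
  (∃ S : SchauderBasis ℂ X, S.basis = x) ∧
    ∃ A : Seq1 ≃L[ℂ] X, ∀ n, A (lp.single 1 n 1) = x n

/-- A w*-Schauder basis of `E`: every `x ∈ E` has a unique weak*-convergent expansion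
`x = ∑ α_n x_n`, i.e. `⟨L, x⟩ = ∑ α_n ⟨L, x_n⟩` for all `L` in the predual of `E`. -/
def IsWeakStarSchauderBasis {E : Submodule ℂ Hinf} (x : ℕ → E) : Prop :=
  ∀ y : E, ∃! α : ℕ → ℂ, ∀ L : Predual E,
    Tendsto (fun N => ∑ n ∈ Finset.range N, α n * Predual.apply L (x n)) atTop
      (𝓝 (Predual.apply L y))

/-- An `ℓ^∞`-basis of `E`: a w*-Schauder basis which is w*-equivalent to the canonical w*-Schauder
basis `(ε_n)` of `ℓ^∞`. -/
def IsSeqInfBasis {E : Submodule ℂ Hinf} (x : ℕ → E) : Prop :=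
  IsWeakStarSchauderBasis x ∧
    ∃ A : SeqInf ≃ₗ[ℂ] E, IsWeakStarHomeo A A.symm ∧ ∀ n, A (lp.single ∞ n 1) = x n

/-- The map `𝒥 : H^∞ → ℓ^∞`, `h ↦ (h(b_n))_n`. -/
def interpMap (b : ℕ → UDisc) (h : Hinf) : SeqInf :=
  ⟨fun n => h.val (b n), memℓp_infty ⟨‖h.toBCF‖, by
    rintro _ ⟨n, rfl⟩
    exact h.toBCF.norm_coe_le_norm (b n)⟩⟩

/-- `(b_n)` is an interpolating sequence: `𝒥` maps `H^∞` onto `ℓ^∞`. -/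
def IsInterpolating (b : ℕ → UDisc) : Prop :=
  Function.Surjective (interpMap b)

/-- The interpolation constant of `(b_n)`: the infimum of all `C ≥ 0` such that every `c ∈ ℓ^∞`
is interpolated at `(b_n)` by some `h ∈ H^∞` with `‖h‖ ≤ C ‖c‖`. -/
def interpConst (b : ℕ → UDisc) : ℝ :=
  sInf {C : ℝ | 0 ≤ C ∧ ∀ c : SeqInf, ∃ h : Hinf, interpMap b h = c ∧ ‖h‖ ≤ C * ‖c‖}

/-- `β_k(b_j) = δ_{kj}` for all `j, k`, and `sup_{z ∈ 𝔻} ∑_n |β_n(z)| ≤ M`. -/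
def IsBeurlingSystem (b : ℕ → UDisc) (β : ℕ → Hinf) (M : ℝ) : Prop :=
  (∀ k j, (β k).val (b j) = if k = j then 1 else 0) ∧
    ∀ z : UDisc, Summable (fun n => ‖(β n).val z‖) ∧ ∑' n, ‖(β n).val z‖ ≤ M

end

noncomputable section

/-! Part (1). Put `S c = ∑ c_n β_n`. The bound on `∑ |β_n|` gives `‖S‖ ≤ M`, and `β_k(b_j) = δ_{kj}`
gives `𝒥 S = id`, so `S` is a norm isomorphism onto its range `E` with inverse `𝒥`. The weak*
statements rest on two facts. First, bounded pointwise convergence on the disc implies weak*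
convergence (`tendsto_pairing`): trigonometric polynomials are dense in `L^1(𝕋)`, and pairing `h`
with `w ^ k` is a mean over a circle inside the disc. Second, for `a ∈ ℓ^1` the functional `h ↦ ∑
a_n h(b_n)` is represented by the `L^1` function `∑ a_n P_{b_n}`, with `P_b` the Poisson kernels
(`exists_pairing_eq_tsum`), so `𝒥` is weak*-continuous.

The partial sums of `S c` are bounded and converge pointwise, hence weak*. So a weak*-continuous
functional composed with `S` is the sum of its values on the unit sequences, and such a functional
on `ℓ^∞` comes from `ℓ^1` (`exists_seq1_of_tendsto`). Applied to `⟨f, ·⟩`, this makes `S`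
weak*-continuous. Then `S 𝒥` is a weak*-continuous projection onto `E`, so `E` is weak*-closed.
Applied to `L ∈ 𝒬_E`, it writes `L` as `∑ a_n E_{b_n}` with `‖a‖ ≤ M ‖L‖`, which identifies `𝒬_E`
with `ℓ^1`.

Part (2). Interpolate the `N` characters of `ℤ/N` along `(b_n)` by functions `f_j` with `‖f_j‖ ≤ C`.
Their finite Fourier transforms `g_k` satisfy `g_k(b_j) = δ_{kj}` for `k, j < N`, and by Parseval `∑
|g_k|^2` is the average of the `|f_j|^2`, hence at most `C^2`. The squares `g_k^2` therefore solve
the problem at the first `N` points. Letting `N → ∞` and `C → M_0`, a pointwise limit along an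
ultrafilter solves it at all points. -/

lemma discExt_coe (f : UDisc → ℂ) (z : UDisc) : discExt f z = f z := by
  unfold discExt; rw [dif_pos z.2]

lemma discExt_of_mem (f : UDisc → ℂ) {z : ℂ} (hz : z ∈ ball (0 : ℂ) 1) :
    discExt f z = f ⟨z, hz⟩ := by
  unfold discExt; rw [dif_pos hz]

lemma discExt_of_notMem (f : UDisc → ℂ) {z : ℂ} (hz : z ∉ ball (0 : ℂ) 1) :
    discExt f z = 0 := by
  unfold discExt; rw [dif_neg hz]

/-! ### Bounded analytic functions: equicontinuity, pointwise limits, completeness -/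

namespace Hinf

lemma differentiableOn (h : Hinf) : DifferentiableOn ℂ (discExt h.val) (ball (0 : ℂ) 1) :=
  Subtype.prop (p := (· ∈ hinfSubmodule)) h

lemma norm_val_le (h : Hinf) (z : UDisc) : ‖h.val z‖ ≤ ‖h‖ :=
  h.toBCF.norm_coe_le_norm z

lemma norm_discExt_le (h : Hinf) (z : ℂ) : ‖discExt h.val z‖ ≤ ‖h‖ := by
  by_cases hz : z ∈ ball (0 : ℂ) 1
  · rw [discExt_of_mem _ hz]; exact h.norm_val_le _
  · rw [discExt_of_notMem _ hz, norm_zero]; exact norm_nonneg _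

lemma norm_le {h : Hinf} {C : ℝ} (hC : 0 ≤ C) (H : ∀ z, ‖h.val z‖ ≤ C) : ‖h‖ ≤ C :=
  (BoundedContinuousFunction.norm_le (f := h.toBCF) hC).2 H

@[ext]
lemma ext {g h : Hinf} (H : ∀ z, g.val z = h.val z) : g = h :=
  Subtype.ext (BoundedContinuousFunction.ext H)

@[simp] lemma val_add (g h : Hinf) (z : UDisc) : (g + h).val z = g.val z + h.val z := rfl
@[simp] lemma val_smul (c : ℂ) (h : Hinf) (z : UDisc) : (c • h).val z = c * h.val z := rfl

/-- Evaluation at a point of the disc, as a bounded functional on `H^∞`. -/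
def evalCLM (z : UDisc) : Hinf →L[ℂ] ℂ :=
  LinearMap.mkContinuous
    { toFun := fun h => h.val z
      map_add' := fun _ _ => rfl
      map_smul' := fun _ _ => rfl } 1 fun h => by
    rw [one_mul]; exact h.norm_val_le z

@[simp] lemma evalCLM_apply (z : UDisc) (h : Hinf) : evalCLM z h = h.val z := rfl

@[simp] lemma val_sum {ι : Type*} (s : Finset ι) (f : ι → Hinf) (z : UDisc) :
    (∑ i ∈ s, f i).val z = ∑ i ∈ s, (f i).val z := by
  simp only [← evalCLM_apply, map_sum]

lemma discExt_val_add (g h : Hinf) (z : ℂ) :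
    discExt (g + h).val z = discExt g.val z + discExt h.val z := by
  by_cases hz : z ∈ ball (0 : ℂ) 1
  · simp [discExt_of_mem _ hz]
  · simp [discExt_of_notMem _ hz]

lemma discExt_val_smul (c : ℂ) (h : Hinf) (z : ℂ) :
    discExt (c • h).val z = c * discExt h.val z := by
  by_cases hz : z ∈ ball (0 : ℂ) 1
  · simp [discExt_of_mem _ hz]
  · simp [discExt_of_notMem _ hz]

/-- The element of `H^∞` given by a bounded holomorphic function on the disc. -/
def mk (f : UDisc → ℂ) (hf : DifferentiableOn ℂ (discExt f) (ball (0 : ℂ) 1)) (C : ℝ)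
    (hC : ∀ z, ‖f z‖ ≤ C) : Hinf :=
  ⟨BoundedContinuousFunction.ofNormedAddCommGroup f
    (by
      have := continuousOn_iff_continuous_domRestrict.1 hf.continuousOn
      refine this.congr fun z => ?_
      exact discExt_coe f z) C hC, hf⟩

@[simp] lemma mk_val (f : UDisc → ℂ) (hf : DifferentiableOn ℂ (discExt f) (ball (0 : ℂ) 1))
    (C : ℝ) (hC : ∀ z, ‖f z‖ ≤ C) (z : UDisc) : (mk f hf C hC).val z = f z := rfl

/-- A bounded family in `H^∞` is equicontinuous on the disc. -/
lemma equicontinuous {ι : Type*} {F : ι → Hinf} {C : ℝ} (hF : ∀ i, ‖F i‖ ≤ C) :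
    Equicontinuous fun i => (F i).val := by
  intro z₀
  have hz₀ : ‖(z₀ : ℂ)‖ < 1 := mem_ball_zero_iff.1 z₀.2
  set R : ℝ := 1 - ‖(z₀ : ℂ)‖ with hR
  have hR0 : 0 < R := by linarith
  have hsub : ball (z₀ : ℂ) R ⊆ ball (0 : ℂ) 1 := by
    apply ball_subset_ball'
    simp [hR]
  -- The modulus is the Schwarz lemma on the disc of radius `R` about `z₀`, which every `F i` maps
  -- into the closed disc of radius `2 * C` about `F i z₀`.
  refine Metric.equicontinuousAt_of_continuity_modulus (fun z : UDisc => 2 * C / R * dist z z₀) ?_ _ ?_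
  · have : Continuous fun z : UDisc => 2 * C / R * dist z z₀ := by fun_prop
    simpa using this.tendsto z₀
  · have hev : ∀ᶠ z : UDisc in 𝓝 z₀, z ∈ ball z₀ R := ball_mem_nhds _ hR0
    filter_upwards [hev] with z hz i
    have := Complex.dist_le_div_mul_dist_of_mapsTo_ball (f := discExt (F i).val) (c := z₀)
      (R₁ := R) (R₂ := 2 * C) (z := z) ((F i).differentiableOn.mono hsub) (by
        intro w _
        rw [mem_closedBall, dist_eq_norm]
        refine (norm_sub_le _ _).trans ?_
        have h1 := ((F i).norm_discExt_le w).trans (hF i)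
        have h2 := ((F i).norm_discExt_le z₀).trans (hF i)
        linarith) hz
    rw [discExt_coe, discExt_coe] at this
    rw [dist_comm]
    exact this

/-- A bounded pointwise limit of functions in `H^∞` is in `H^∞`. -/
lemma exists_val_eq_of_tendsto {ι : Type*} {l : Filter ι} [l.NeBot] {F : ι → Hinf} {C : ℝ}
    (hF : ∀ i, ‖F i‖ ≤ C) {g : UDisc → ℂ} (hg : ∀ z, Tendsto (fun i => (F i).val z) l (𝓝 (g z))) :
    ∃ h : Hinf, (∀ z, h.val z = g z) ∧ ‖h‖ ≤ C := by
  have hbound : ∀ z, ‖g z‖ ≤ C := fun z =>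
    le_of_tendsto (hg z).norm (Eventually.of_forall fun i => ((F i).norm_val_le z).trans (hF i))
  have hunif : ∀ K ∈ {K : Set UDisc | IsCompact K},
      TendstoUniformlyOn (fun i => (F i).val) g l K := by
    have h1 := (EquicontinuousOn.tendsto_uniformOnFun_iff_pi (F := fun i => (F i).val)
      (𝔖 := {K : Set UDisc | IsCompact K}) (fun K hK => hK)
      (by
        rw [Set.eq_univ_iff_forall]
        exact fun z => ⟨{z}, isCompact_singleton, rfl⟩)
      (fun K _ => (equicontinuous hF).equicontinuousOn K) l g).2 (tendsto_pi_nhds.2 hg)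
    exact UniformOnFun.tendsto_iff_tendstoUniformlyOn.1 h1
  have hloc : TendstoLocallyUniformlyOn (fun i => discExt (F i).val) (discExt g) l
      (ball (0 : ℂ) 1) := by
    rw [tendstoLocallyUniformlyOn_iff_forall_isCompact isOpen_ball]
    intro K hK hKc
    have hK' : IsCompact ((↑) ⁻¹' K : Set UDisc) := by
      rw [Topology.IsEmbedding.subtypeVal.isCompact_iff, Subtype.image_preimage_coe,
        Set.inter_eq_right.2 hK]
      exact hKc
    have := hunif _ hK'
    rw [Metric.tendstoUniformlyOn_iff] at this ⊢
    intro ε hε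
    filter_upwards [this ε hε] with i hi z hz
    rw [discExt_of_mem _ (hK hz), discExt_of_mem _ (hK hz)]
    exact hi ⟨z, hK hz⟩ hz
  have hd := hloc.differentiableOn (Eventually.of_forall fun i => (F i).differentiableOn)
    isOpen_ball
  obtain ⟨i⟩ := l.nonempty_of_neBot
  exact ⟨mk g hd C hbound, fun z => rfl, norm_le ((norm_nonneg _).trans (hF i)) hbound⟩

lemma isometry_toBCF : Isometry toBCF := fun _ _ => rfl

/-- Completeness is needed for the open mapping theorem, applied to `𝒥` in
`exists_interp_of_interpConst_lt`. -/
instance : CompleteSpace Hinf := by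
  refine Metric.complete_of_cauchySeq_tendsto fun u hu => ?_
  obtain ⟨g, hg⟩ := cauchySeq_tendsto_of_complete (isometry_toBCF.uniformContinuous.comp_cauchySeq hu)
  obtain ⟨C, hC⟩ := hu.norm_bddAbove
  obtain ⟨h, hh, -⟩ := exists_val_eq_of_tendsto (l := atTop) (F := u) (C := C) (g := g)
    (fun i => hC ⟨i, rfl⟩) fun z => ((continuous_eval_const z).tendsto g).comp hg
  have hgh : h.toBCF = g := BoundedContinuousFunction.ext hh
  refine ⟨h, isometry_toBCF.isEmbedding.tendsto_nhds_iff.2 ?_⟩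
  rwa [hgh]

end Hinf

/-! ### The pairing with `L^1(𝕋)` and bounded pointwise convergence -/

lemma norm_circleAverage_mul_le {f g : ℂ → ℂ} {C : ℝ} (hf : CircleIntegrable f 0 1)
    (hg : ∀ z, ‖g z‖ ≤ C) :
    ‖circleAverage (fun w => f w * g w) 0 1‖ ≤ C * circleAverage (fun w => ‖f w‖) 0 1 := by
  rw [circleAverage_def, circleAverage_def, norm_smul, smul_eq_mul, Real.norm_of_nonneg (by positivity),
    mul_left_comm]
  refine mul_le_mul_of_nonneg_left ?_ (by positivity)
  rw [← intervalIntegral.integral_const_mul]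
  refine intervalIntegral.norm_integral_le_of_norm_le two_pi_pos.le ?_ ?_
  · refine Eventually.of_forall fun θ _ => ?_
    rw [norm_mul, mul_comm]
    exact mul_le_mul_of_nonneg_right (hg _) (norm_nonneg _)
  · exact (IntervalIntegrable.norm hf).const_mul C

lemma circleAverage_norm_nonneg (f : ℂ → ℂ) : 0 ≤ circleAverage (fun w => ‖f w‖) 0 1 := by
  rw [circleAverage_def]
  refine smul_nonneg (by positivity) ?_
  exact intervalIntegral.integral_nonneg two_pi_pos.le fun _ _ => norm_nonneg _

/-- Trigonometric polynomials are dense in `L^1` of the unit circle. -/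
lemma exists_trigPolynomial_near {f : ℂ → ℂ} (hf : CircleIntegrable f 0 1) {ε : ℝ} (hε : 0 < ε) :
    ∃ (s : Finset ℤ) (c : ℤ → ℂ),
      circleAverage (fun w => ‖f w - ∑ k ∈ s, c k * w ^ k‖) 0 1 < ε := by
  have : Fact (0 < 2 * π) := ⟨two_pi_pos⟩
  -- Under `θ ↦ e^{iθ}` the powers `w ^ k` become the Fourier characters of `ℝ/2πℤ`, whose span is
  -- dense in `L^1`.
  set F : AddCircle (2 * π) → ℂ := AddCircle.liftIoc (2 * π) 0 fun θ => f (circleMap 0 1 θ) with hF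
  have hmem : MeasureTheory.MemLp F 1 (AddCircle.haarAddCircle (T := 2 * π)) := by
    rw [MeasureTheory.memLp_haarAddCircle_iff]
    apply MeasureTheory.MemLp.memLp_liftIoc
    rw [MeasureTheory.memLp_one_iff_integrable, zero_add]
    exact (intervalIntegrable_iff_integrableOn_Ioc_of_le two_pi_pos.le).1 hf
  have hdense := span_fourierLp_closure_eq_top (T := 2 * π) (p := 1) (by simp)
  have hcl : hmem.toLp F ∈ closure
      (Submodule.span ℂ (Set.range (fourierLp (T := 2 * π) 1)) : Set _) := by
    rw [← Submodule.topologicalClosure_coe, hdense]; trivial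
  obtain ⟨p, hp, hd⟩ := Metric.mem_closure_iff.1 hcl ε hε
  obtain ⟨c, hc⟩ := Finsupp.mem_span_range_iff_exists_finsupp.1 hp
  refine ⟨c.support, c, ?_⟩
  have hae : (hmem.toLp F - p : MeasureTheory.Lp ℂ 1 (AddCircle.haarAddCircle (T := 2 * π)))
      =ᵐ[AddCircle.haarAddCircle] fun x => F x - ∑ k ∈ c.support, c k * fourier k x := by
    have h2 : (p : AddCircle (2 * π) → ℂ) =ᵐ[AddCircle.haarAddCircle]
        fun x => ∑ k ∈ c.support, c k * fourier k x := by
      have hpc : p = ContinuousMap.toLp (E := ℂ) 1 AddCircle.haarAddCircle ℂ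
          (∑ k ∈ c.support, c k • fourier k) := by
        rw [← hc, Finsupp.sum, map_sum]
        simp only [map_smul]
      rw [hpc]
      filter_upwards [ContinuousMap.coeFn_toLp (p := 1) (𝕜 := ℂ) AddCircle.haarAddCircle
        (∑ k ∈ c.support, c k • fourier (T := 2 * π) k)] with x hx
      rw [hx]
      simp
    filter_upwards [MeasureTheory.Lp.coeFn_sub (hmem.toLp F) p, hmem.coeFn_toLp, h2] with x h3 h4 h5
    rw [h3, Pi.sub_apply, h4, h5]
  rw [dist_eq_norm, MeasureTheory.L1.norm_eq_integral_norm] at hd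
  rw [MeasureTheory.integral_congr_ae (hae.mono fun x hx => by rw [hx]),
    AddCircle.integral_haarAddCircle, ← AddCircle.intervalIntegral_preimage (2 * π) 0] at hd
  refine lt_of_eq_of_lt ?_ hd
  rw [circleAverage_def, zero_add]
  congr 1
  rw [intervalIntegral.integral_of_le two_pi_pos.le, intervalIntegral.integral_of_le two_pi_pos.le]
  refine MeasureTheory.setIntegral_congr_fun measurableSet_Ioc fun θ hθ => ?_
  have h6 : F (θ : AddCircle (2 * π)) = f (circleMap 0 1 θ) :=
    AddCircle.liftIoc_coe_apply (by simpa using hθ)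
  simp only [h6]
  congr 2
  refine Finset.sum_congr rfl fun k _ => ?_
  rw [fourier_coe_apply, circleMap, zero_add, Complex.ofReal_one, one_mul, ← Complex.exp_int_mul]
  congr 2
  push_cast
  field_simp

/-- The pairing of `f` with the dilation `h_r` of `h`. -/
def dilPairing (f : ℂ → ℂ) (h : Hinf) (r : ℝ) : ℂ :=
  circleAverage (fun w : ℂ => f w * discExt h.val ((r : ℂ) * w)) 0 1

lemma eventually_mem_Ioo : ∀ᶠ r : ℝ in 𝓝[<] 1, r ∈ Set.Ioo (0 : ℝ) 1 :=
  Ioo_mem_nhdsLT one_pos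

lemma norm_dilPairing_le {f : ℂ → ℂ} (hf : CircleIntegrable f 0 1) (h : Hinf) (r : ℝ) :
    ‖dilPairing f h r‖ ≤ ‖h‖ * circleAverage (fun w => ‖f w‖) 0 1 :=
  norm_circleAverage_mul_le hf fun _ => h.norm_discExt_le _

lemma circleIntegrable_mul_dil {f : ℂ → ℂ} (hf : CircleIntegrable f 0 1) (h : Hinf) {r : ℝ}
    (hr : r ∈ Set.Ioo (0 : ℝ) 1) :
    CircleIntegrable (fun w : ℂ => f w * discExt h.val ((r : ℂ) * w)) 0 1 := by
  refine IntervalIntegrable.mul_continuousOn hf (Continuous.continuousOn ?_)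
  refine h.differentiableOn.continuousOn.comp_continuous (by fun_prop) fun θ => ?_
  simp [abs_of_pos hr.1, hr.2]

lemma dilPairing_sub {f g : ℂ → ℂ} (hf : CircleIntegrable f 0 1) (hg : CircleIntegrable g 0 1)
    (h : Hinf) {r : ℝ} (hr : r ∈ Set.Ioo (0 : ℝ) 1) :
    dilPairing (fun w => f w - g w) h r = dilPairing f h r - dilPairing g h r := by
  unfold dilPairing
  rw [← circleAverage_fun_sub (circleIntegrable_mul_dil hf h hr) (circleIntegrable_mul_dil hg h hr)]
  simp only [sub_mul]

/-- The mean of `z ^ k h(z)` over the circle of radius `1 / 2`: a Taylor coefficient of `h`, or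
zero. -/
def taylorMean (k : ℤ) (h : Hinf) : ℂ :=
  circleAverage (fun z : ℂ => z ^ k * discExt h.val z) 0 (1 / 2)

/-- `z ^ k h(z)` is holomorphic in the punctured disc, so Cauchy's theorem on the annulus applies.
The power `k` may be negative. -/
lemma circleAverage_zpow_mul_eq (k : ℤ) (h : Hinf) {r R : ℝ} (hr : 0 < r) (hrR : r ≤ R)
    (hR : R < 1) :
    circleAverage (fun z : ℂ => z ^ k * discExt h.val z) 0 R =
      circleAverage (fun z : ℂ => z ^ k * discExt h.val z) 0 r := by
  have hd : ∀ z ∈ ball (0 : ℂ) 1, z ≠ 0 →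
      DifferentiableAt ℂ (fun z : ℂ => z ^ k * discExt h.val z) z := fun z hz hz0 =>
    (differentiableAt_zpow.2 (Or.inl hz0)).mul
      (h.differentiableOn.differentiableAt (isOpen_ball.mem_nhds hz))
  rw [circleAverage_eq_circleIntegral hr.ne', circleAverage_eq_circleIntegral (hr.trans_le hrR).ne',
    Complex.circleIntegral_sub_center_inv_smul_eq_of_differentiable_on_annulus_off_countable hr hrR
      Set.countable_empty]
  · rintro z ⟨hz1, hz2⟩
    refine (hd z (closedBall_subset_ball hR hz1) ?_).continuousAt.continuousWithinAt
    rintro rfl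
    exact hz2 (mem_ball_self hr)
  · rintro z ⟨⟨hz1, hz2⟩, -⟩
    refine hd z (ball_subset_ball hR.le hz1) ?_
    rintro rfl
    exact hz2 (mem_closedBall_self hr.le)

/-- After the substitution `z = r w`, independence of the radius leaves a fixed mean times a power
of `r`, so the limit as `r ↑ 1` is evident. -/
lemma dilPairing_zpow (k : ℤ) (h : Hinf) {r : ℝ} (hr : r ∈ Set.Ioo (0 : ℝ) 1) :
    dilPairing (fun w => w ^ k) h r = (r : ℂ) ^ (-k) * taylorMean k h := by
  have h1 : taylorMean k h = circleAverage (fun z : ℂ => z ^ k * discExt h.val z) 0 r := by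
    rcases le_total r (1 / 2) with h | h
    · exact circleAverage_zpow_mul_eq k _ hr.1 h (by norm_num)
    · exact (circleAverage_zpow_mul_eq k _ (by norm_num) h hr.2).symm
  have hr0 : (r : ℂ) ≠ 0 := by exact_mod_cast hr.1.ne'
  rw [h1, circleAverage_eq_circleAverage_zero_one, ← smul_eq_mul, ← circleAverage_fun_smul]
  unfold dilPairing
  congr 1
  ext w
  rw [add_zero, mul_zpow, zpow_neg, smul_eq_mul]
  field_simp

lemma circleIntegrable_zpow (k : ℤ) : CircleIntegrable (fun w : ℂ => w ^ k) 0 1 := by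
  refine ContinuousOn.circleIntegrable zero_le_one fun z hz => ?_
  refine (continuousAt_zpow₀ z k (Or.inl ?_)).continuousWithinAt
  rintro rfl
  simp at hz

lemma circleIntegrable_trigPolynomial (s : Finset ℤ) (c : ℤ → ℂ) :
    CircleIntegrable (fun w : ℂ => ∑ k ∈ s, c k * w ^ k) 0 1 :=
  CircleIntegrable.fun_sum s fun k _ => (circleIntegrable_zpow k).const_mul (c k)

lemma tendsto_dilPairing_trigPolynomial (s : Finset ℤ) (c : ℤ → ℂ) (h : Hinf) :
    Tendsto (dilPairing (fun w => ∑ k ∈ s, c k * w ^ k) h) (𝓝[<] 1)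
      (𝓝 (∑ k ∈ s, c k * taylorMean k h)) := by
  have h1 : Tendsto (fun r : ℝ => ∑ k ∈ s, c k * ((r : ℂ) ^ (-k) * taylorMean k h)) (𝓝[<] 1)
      (𝓝 (∑ k ∈ s, c k * (((1 : ℝ) : ℂ) ^ (-k) * taylorMean k h))) := by
    refine tendsto_finsetSum s fun k _ => Tendsto.const_mul _ (Tendsto.mul_const _ ?_)
    refine Tendsto.mono_left ?_ nhdsWithin_le_nhds
    refine ((continuousAt_zpow₀ _ (-k) (Or.inl ?_)).comp
      Complex.continuous_ofReal.continuousAt).tendsto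
    simp
  simp only [Complex.ofReal_one, one_zpow, one_mul] at h1
  refine h1.congr' ?_
  filter_upwards [eventually_mem_Ioo] with r hr
  simp only [← dilPairing_zpow _ h hr]
  unfold dilPairing
  simp only [← smul_eq_mul, ← circleAverage_fun_smul]
  rw [← circleAverage_fun_sum]
  · simp only [smul_eq_mul, Finset.sum_mul, mul_assoc]
  · intro k _
    exact (circleIntegrable_mul_dil (circleIntegrable_zpow k) h hr).const_mul (c k)

/-- The limit defining the pairing exists. -/
lemma tendsto_dilPairing {f : ℂ → ℂ} (hf : CircleIntegrable f 0 1) (h : Hinf) :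
    Tendsto (dilPairing f h) (𝓝[<] 1) (𝓝 (pairing f h)) := by
  refine tendsto_nhds_limUnder (cauchy_map_iff_exists_tendsto.1 ?_)
  rw [Metric.cauchy_iff]
  refine ⟨inferInstance, fun ε hε => ?_⟩
  -- The summand `1` keeps the denominator positive when `h = 0`.
  obtain ⟨s, c, hp⟩ := exists_trigPolynomial_near hf (ε := ε / (4 * (‖h‖ + 1))) (by positivity)
  set p : ℂ → ℂ := fun w => ∑ k ∈ s, c k * w ^ k
  have hpi : CircleIntegrable p 0 1 := circleIntegrable_trigPolynomial s c
  set L := ∑ k ∈ s, c k * taylorMean k h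
  refine ⟨ball L (ε / 2), ?_, fun x hx y hy => ?_⟩
  · rw [mem_map]
    filter_upwards [eventually_mem_Ioo, (Metric.tendsto_nhds.1
      (tendsto_dilPairing_trigPolynomial s c h)) (ε / 4) (by positivity)] with r hr h1
    have h2 : ‖dilPairing f h r - dilPairing p h r‖ ≤ ε / 4 := by
      rw [← dilPairing_sub hf hpi h hr]
      refine (norm_dilPairing_le (hf.sub hpi) h r).trans ?_
      refine (mul_le_mul_of_nonneg_left hp.le (norm_nonneg _)).trans ?_
      rw [← mul_div_assoc, div_le_div_iff₀ (by positivity) (by positivity)]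
      nlinarith [norm_nonneg h]
    change dist _ _ < _
    have := dist_triangle (dilPairing f h r) (dilPairing p h r) L
    rw [← dist_eq_norm] at h2
    linarith
  · have := dist_triangle_right x y L
    rw [mem_ball] at hx hy
    linarith

lemma pairing_trigPolynomial (s : Finset ℤ) (c : ℤ → ℂ) (h : Hinf) :
    pairing (fun w => ∑ k ∈ s, c k * w ^ k) h = ∑ k ∈ s, c k * taylorMean k h :=
  tendsto_nhds_unique (tendsto_dilPairing (circleIntegrable_trigPolynomial s c) h)
    (tendsto_dilPairing_trigPolynomial s c h)

lemma norm_pairing_le {f : ℂ → ℂ} (hf : CircleIntegrable f 0 1) (h : Hinf) :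
    ‖pairing f h‖ ≤ ‖h‖ * circleAverage (fun w => ‖f w‖) 0 1 :=
  le_of_tendsto (tendsto_dilPairing hf h).norm (Eventually.of_forall (norm_dilPairing_le hf h))

lemma pairing_fun_sub {f g : ℂ → ℂ} (hf : CircleIntegrable f 0 1) (hg : CircleIntegrable g 0 1)
    (h : Hinf) : pairing (fun w => f w - g w) h = pairing f h - pairing g h := by
  refine tendsto_nhds_unique (tendsto_dilPairing (hf.sub hg) h)
    (((tendsto_dilPairing hf h).sub (tendsto_dilPairing hg h)).congr' ?_)
  filter_upwards [eventually_mem_Ioo] with r hr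
  exact (dilPairing_sub hf hg h hr).symm

lemma pairing_add {f : ℂ → ℂ} (hf : CircleIntegrable f 0 1) (g h : Hinf) :
    pairing f (g + h) = pairing f g + pairing f h := by
  refine tendsto_nhds_unique (tendsto_dilPairing hf (g + h))
    (((tendsto_dilPairing hf g).add (tendsto_dilPairing hf h)).congr' ?_)
  filter_upwards [eventually_mem_Ioo] with r hr
  unfold dilPairing
  rw [← circleAverage_fun_add (circleIntegrable_mul_dil hf g hr) (circleIntegrable_mul_dil hf h hr)]
  simp only [Hinf.discExt_val_add, mul_add]

lemma pairing_smul {f : ℂ → ℂ} (hf : CircleIntegrable f 0 1) (c : ℂ) (h : Hinf) :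
    pairing f (c • h) = c * pairing f h := by
  refine tendsto_nhds_unique (tendsto_dilPairing hf (c • h))
    (((tendsto_dilPairing hf h).const_mul c).congr fun r => ?_)
  unfold dilPairing
  rw [← smul_eq_mul, ← circleAverage_fun_smul]
  simp only [Hinf.discExt_val_smul, smul_eq_mul, mul_left_comm]

/-- The functional `⟨f, ·⟩` on `H^∞`. -/
def pairingCLM {f : ℂ → ℂ} (hf : CircleIntegrable f 0 1) : Hinf →L[ℂ] ℂ :=
  LinearMap.mkContinuous
    { toFun := pairing f
      map_add' := pairing_add hf
      map_smul' := pairing_smul hf } (circleAverage (fun w => ‖f w‖) 0 1) fun h => by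
    rw [mul_comm]; exact norm_pairing_le hf h

/-- Dominated convergence on the circle of radius `1 / 2`, where the pointwise hypothesis applies
directly and no boundary values intervene. -/
lemma tendsto_taylorMean {ι : Type*} {l : Filter ι} [l.IsCountablyGenerated] {F : ι → Hinf}
    {h : Hinf} {C : ℝ} (hF : ∀ i, ‖F i‖ ≤ C)
    (hlim : ∀ z, Tendsto (fun i => (F i).val z) l (𝓝 (h.val z))) (k : ℤ) :
    Tendsto (fun i => taylorMean k (F i)) l (𝓝 (taylorMean k h)) := by
  have hmem : ∀ θ : ℝ, circleMap 0 (1 / 2) θ ∈ ball (0 : ℂ) 1 := fun θ => by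
    rw [mem_ball_zero_iff, norm_circleMap_zero]
    norm_num
  have hz : ∀ θ : ℝ, circleMap 0 (1 / 2) θ ≠ 0 := fun θ => circleMap_ne_center (by norm_num)
  have hcont : Continuous fun θ : ℝ => (circleMap 0 (1 / 2) θ) ^ k :=
    (continuous_circleMap 0 (1 / 2)).zpow₀ k fun θ => Or.inl (hz θ)
  refine Tendsto.const_smul ?_ _
  refine intervalIntegral.tendsto_integral_filter_of_dominated_convergence
    (fun θ => ‖(circleMap 0 (1 / 2) θ) ^ k‖ * C) ?_ ?_ ?_ ?_
  · refine Eventually.of_forall fun i => Continuous.aestronglyMeasurable ?_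
    exact hcont.mul ((F i).differentiableOn.continuousOn.comp_continuous
      (continuous_circleMap 0 (1 / 2)) hmem)
  · refine Eventually.of_forall fun i => Eventually.of_forall fun θ _ => ?_
    rw [norm_mul]
    exact mul_le_mul_of_nonneg_left (((F i).norm_discExt_le _).trans (hF i)) (norm_nonneg _)
  · exact (hcont.norm.mul_const C).intervalIntegrable _ _
  · refine Eventually.of_forall fun θ _ => Tendsto.const_mul _ ?_
    simp only [discExt_of_mem _ (hmem θ)]
    exact hlim _

/-- Bounded pointwise convergence on the disc implies weak* convergence. -/
lemma tendsto_pairing {ι : Type*} {l : Filter ι} [l.IsCountablyGenerated] {F : ι → Hinf}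
    {h : Hinf} {C : ℝ} (hF : ∀ i, ‖F i‖ ≤ C)
    (hlim : ∀ z, Tendsto (fun i => (F i).val z) l (𝓝 (h.val z)))
    {f : ℂ → ℂ} (hf : CircleIntegrable f 0 1) :
    Tendsto (fun i => pairing f (F i)) l (𝓝 (pairing f h)) := by
  rw [Metric.tendsto_nhds]
  intro ε hε
  set D : ℝ := max ‖h‖ C
  have hD : 0 ≤ D := (norm_nonneg h).trans (le_max_left _ _)
  obtain ⟨s, c, hp⟩ := exists_trigPolynomial_near hf (ε := ε / (4 * (D + 1))) (by positivity)
  set p : ℂ → ℂ := fun w => ∑ k ∈ s, c k * w ^ k with hpdef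
  have hpi : CircleIntegrable p 0 1 := circleIntegrable_trigPolynomial s c
  have key : ∀ g : Hinf, ‖g‖ ≤ D → dist (pairing f g) (pairing p g) ≤ ε / 4 := fun g hg => by
    rw [dist_eq_norm, ← pairing_fun_sub hf hpi]
    refine (norm_pairing_le (hf.sub hpi) g).trans ?_
    refine (mul_le_mul hg hp.le (circleAverage_norm_nonneg _) hD).trans ?_
    rw [← mul_div_assoc, div_le_div_iff₀ (by positivity) (by positivity)]
    nlinarith
  have hplim : Tendsto (fun i => pairing p (F i)) l (𝓝 (pairing p h)) := by
    simp only [hpdef, pairing_trigPolynomial]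
    exact tendsto_finsetSum s fun k _ => (tendsto_taylorMean hF hlim k).const_mul _
  filter_upwards [(Metric.tendsto_nhds.1 hplim) (ε / 4) (by positivity)] with i hi
  have h1 := key (F i) ((hF i).trans (le_max_right _ _))
  have h2 := key h (le_max_left _ _)
  have := dist_triangle4_right (pairing f (F i)) (pairing f h) (pairing p (F i)) (pairing p h)
  linarith

/-! ### Poisson kernels: point evaluations as weak*-continuous functionals -/

lemma circleIntegrable_poissonKernel (b : UDisc) :
    CircleIntegrable (fun w => (poissonKernel 0 b w : ℂ)) 0 1 := by
  have hb : ‖(b : ℂ)‖ < 1 := mem_ball_zero_iff.1 b.2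
  refine ContinuousOn.circleIntegrable zero_le_one ?_
  refine Complex.continuous_ofReal.comp_continuousOn ?_
  unfold poissonKernel
  refine ContinuousOn.div (by fun_prop) (by fun_prop) fun z hz => ?_
  have hz1 : ‖z‖ = 1 := mem_sphere_zero_iff_norm.1 hz
  have : z ≠ b := by rintro rfl; exact hb.ne hz1
  simpa [sub_eq_zero] using this

lemma poissonKernel_nonneg_of_mem_sphere (b : UDisc) {z : ℂ} (hz : z ∈ sphere (0 : ℂ) 1) :
    0 ≤ poissonKernel 0 b z := by
  have hb : ‖(b : ℂ)‖ < 1 := mem_ball_zero_iff.1 b.2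
  rw [poissonKernel_def, sub_zero, sub_zero, mem_sphere_zero_iff_norm.1 hz]
  have := norm_nonneg (b : ℂ)
  exact div_nonneg (by nlinarith) (by positivity)

/-- The kernel is nonnegative on the circle and reproduces the constant `1`. The norm being
independent of `b` is what lets `∑ a_n P_{b_n}` converge in `L^1` for every `a ∈ ℓ^1`. -/
lemma circleAverage_norm_poissonKernel (b : UDisc) :
    circleAverage (fun w => ‖(poissonKernel 0 b w : ℂ)‖) 0 1 = 1 := by
  -- The function `f` here is the constant `1`.
  have h1 := DiffContOnCl.circleAverage_poissonKernel_smul (c := 0) (R := 1)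
    (f := fun _ => (1 : ℝ → ℝ) 0 |> Complex.ofReal) diffContOnCl_const b.2
  have h2 : circleAverage (fun w => ((‖(poissonKernel 0 b w : ℂ)‖ : ℝ) : ℂ)) 0 1 = 1 := by
    refine Eq.trans (circleAverage_congr_sphere fun z hz => ?_) (h1.trans (by simp))
    rw [abs_one] at hz
    simp [abs_of_nonneg (poissonKernel_nonneg_of_mem_sphere b hz)]
  rw [circleAverage_def, intervalIntegral.integral_ofReal] at h2
  rw [circleAverage_def, smul_eq_mul]
  rw [Complex.real_smul] at h2
  exact_mod_cast h2

lemma dilPairing_poissonKernel (b : UDisc) (h : Hinf) {r : ℝ} (hr : r ∈ Set.Ioo (0 : ℝ) 1) :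
    dilPairing (fun w => (poissonKernel 0 b w : ℂ)) h r = discExt h.val (r * b) := by
  have hmaps : ∀ w ∈ closedBall (0 : ℂ) 1, (r : ℂ) * w ∈ ball (0 : ℂ) 1 := fun w hw => by
    rw [mem_closedBall_zero_iff] at hw
    rw [mem_ball_zero_iff, norm_mul, Complex.norm_real, Real.norm_of_nonneg hr.1.le]
    nlinarith [hr.1, hr.2, norm_nonneg w]
  have hd : DiffContOnCl ℂ (fun w => discExt h.val (r * w)) (ball (0 : ℂ) 1) := by
    refine DifferentiableOn.diffContOnCl ?_
    rw [closure_ball _ one_ne_zero]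
    exact h.differentiableOn.comp (by fun_prop) hmaps
  rw [← hd.circleAverage_poissonKernel_smul b.2]
  unfold dilPairing
  congr 1

lemma tendsto_discExt_dil (h : Hinf) (b : UDisc) :
    Tendsto (fun r : ℝ => discExt h.val (r * b)) (𝓝[<] 1) (𝓝 (h.val b)) := by
  have h1 : ContinuousAt (discExt h.val) (b : ℂ) :=
    (h.differentiableOn.differentiableAt (isOpen_ball.mem_nhds b.2)).continuousAt
  rw [← discExt_coe h.val b]
  refine h1.tendsto.comp (Tendsto.mono_left ?_ nhdsWithin_le_nhds)
  have : Continuous fun r : ℝ => (r : ℂ) * b := by fun_prop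
  simpa using this.tendsto 1

lemma Seq1.summable_norm (a : Seq1) : Summable fun n => ‖a n‖ := by
  simpa using (lp.memℓp a).summable (by simp)

lemma Seq1.norm_eq_tsum (a : Seq1) : ‖a‖ = ∑' n, ‖a n‖ := by
  rw [lp.norm_eq_tsum_rpow (by simp)]
  simp

lemma Seq1.summable_mul (a : Seq1) {c : ℕ → ℂ} {C : ℝ} (hc : ∀ n, ‖c n‖ ≤ C) :
    Summable fun n => a n * c n := by
  refine Summable.of_norm_bounded (a.summable_norm.mul_right C) fun n => ?_
  rw [norm_mul]
  exact mul_le_mul_of_nonneg_left (hc n) (norm_nonneg _)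

lemma integrable_tsum_of_summable_integral_norm {α : Type*} [MeasurableSpace α]
    {μ : MeasureTheory.Measure α} {F : ℕ → α → ℂ} (hF : ∀ n, MeasureTheory.Integrable (F n) μ)
    (hs : Summable fun n => ∫ x, ‖F n x‖ ∂μ) :
    MeasureTheory.Integrable (fun x => ∑' n, F n x) μ ∧ ∀ᵐ x ∂μ, Summable fun n => F n x := by
  have hm : ∀ n, AEMeasurable (fun x => ‖F n x‖ₑ) μ := fun n => (hF n).1.enorm
  have hfin : ∫⁻ x, ∑' n, ‖F n x‖ₑ ∂μ < ∞ := by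
    rw [MeasureTheory.lintegral_tsum hm]
    have : ∀ n, ∫⁻ x, ‖F n x‖ₑ ∂μ = ENNReal.ofReal (∫ x, ‖F n x‖ ∂μ) := fun n =>
      (MeasureTheory.ofReal_integral_norm_eq_lintegral_enorm (hF n)).symm
    simp only [this]
    exact hs.tsum_ofReal_lt_top
  have hsum : ∀ᵐ x ∂μ, Summable fun n => F n x := by
    filter_upwards [MeasureTheory.ae_lt_top' (AEMeasurable.tsum hm) hfin.ne] with x hx
    refine Summable.of_norm ?_
    have := ENNReal.summable_toReal hx.ne
    simpa using this
  refine ⟨⟨?_, ?_⟩, hsum⟩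
  · refine aestronglyMeasurable_of_tendsto_ae atTop
      (f := fun N x => ∑ n ∈ Finset.range N, F n x) (fun N => ?_) ?_
    · exact Finset.aestronglyMeasurable_fun_sum _ fun n _ => (hF n).1
    · filter_upwards [hsum] with x hx using hx.hasSum.tendsto_sum_nat
  · exact lt_of_le_of_lt (MeasureTheory.lintegral_mono fun x => enorm_tsum_le_tsum_enorm) hfin

/-- Absolutely summable combinations of point evaluations are given by `L^1` functions on the
circle. -/
lemma exists_pairing_eq_tsum (b : ℕ → UDisc) (a : Seq1) :
    ∃ f : ℂ → ℂ, CircleIntegrable f 0 1 ∧ ∀ h, pairing f h = ∑' n, a n * h.val (b n) := by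
  set μ : MeasureTheory.Measure ℝ := MeasureTheory.volume.restrict (Set.Ioc 0 (2 * π))
  have hint : ∀ g : ℂ → ℂ, CircleIntegrable g 0 1 ↔
      MeasureTheory.Integrable (fun θ => g (circleMap 0 1 θ)) μ := fun g =>
    intervalIntegrable_iff_integrableOn_Ioc_of_le two_pi_pos.le
  set P : ℕ → ℂ → ℂ := fun n w => a n * (poissonKernel 0 (b n) w : ℂ)
  have hP : ∀ n, CircleIntegrable (P n) 0 1 := fun n =>
    (circleIntegrable_poissonKernel (b n)).const_mul (a n)
  have hPnorm : ∀ n, ∫ θ, ‖P n (circleMap 0 1 θ)‖ ∂μ = ‖a n‖ * (2 * π) := fun n => by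
    have := circleAverage_norm_poissonKernel (b n)
    rw [circleAverage_def, smul_eq_mul, inv_mul_eq_iff_eq_mul₀ two_pi_pos.ne', mul_one,
      intervalIntegral.integral_of_le two_pi_pos.le] at this
    rw [← this, ← MeasureTheory.integral_const_mul]
    simp only [P, norm_mul, μ]
  have hs : Summable fun n => ∫ θ, ‖P n (circleMap 0 1 θ)‖ ∂μ := by
    simp only [hPnorm]
    exact a.summable_norm.mul_right _
  obtain ⟨hi, hsum⟩ := integrable_tsum_of_summable_integral_norm (fun n => (hint _).1 (hP n)) hs
  have hf : CircleIntegrable (fun w => ∑' n, P n w) 0 1 := (hint _).2 hi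
  refine ⟨fun w => ∑' n, P n w, hf, fun h => tendsto_nhds_unique (tendsto_dilPairing hf h) ?_⟩
  -- For `r < 1` the sum and the integral may be exchanged and each term is a Poisson integral of
  -- `h_r`. What remains is `r ↑ 1` inside the sum, dominated by `‖a n‖ * ‖h‖`.
  have hlim : Tendsto (fun r : ℝ => ∑' n, a n * discExt h.val (r * b n)) (𝓝[<] 1)
      (𝓝 (∑' n, a n * h.val (b n))) := by
    refine tendsto_tsum_of_dominated_convergence (bound := fun n => ‖a n‖ * ‖h‖)
      (a.summable_norm.mul_right _) (fun n => (tendsto_discExt_dil h (b n)).const_mul _)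
      (Eventually.of_forall fun r n => ?_)
    rw [norm_mul]
    exact mul_le_mul_of_nonneg_left (h.norm_discExt_le _) (norm_nonneg _)
  refine hlim.congr' ?_
  filter_upwards [eventually_mem_Ioo] with r hr
  have hG : ∀ n, MeasureTheory.Integrable
      (fun θ => P n (circleMap 0 1 θ) * discExt h.val (r * circleMap 0 1 θ)) μ := fun n =>
    (hint _).1 (circleIntegrable_mul_dil (hP n) h hr)
  have hGs : Summable fun n =>
      ∫ θ, ‖P n (circleMap 0 1 θ) * discExt h.val (r * circleMap 0 1 θ)‖ ∂μ := by
    refine Summable.of_nonneg_of_le (fun n => MeasureTheory.integral_nonneg fun _ => norm_nonneg _)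
      (fun n => ?_) (hs.mul_right ‖h‖)
    rw [← MeasureTheory.integral_mul_const]
    refine MeasureTheory.integral_mono (hG n).norm (((hint _).1 (hP n)).norm.mul_const _) fun θ => ?_
    simp only [norm_mul]
    exact mul_le_mul_of_nonneg_left (h.norm_discExt_le _) (by positivity)
  have hdil : ∀ n, a n * discExt h.val (r * b n) = (2 * π)⁻¹ •
      ∫ θ, P n (circleMap 0 1 θ) * discExt h.val (r * circleMap 0 1 θ) ∂μ := fun n => by
    rw [← dilPairing_poissonKernel (b n) h hr, dilPairing, ← smul_eq_mul, ← circleAverage_fun_smul,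
      circleAverage_def, intervalIntegral.integral_of_le two_pi_pos.le]
    simp only [smul_eq_mul, P, mul_assoc, μ]
  simp only [hdil]
  rw [tsum_const_smul'' ((2 * π)⁻¹ : ℝ), MeasureTheory.integral_tsum_of_summable_integral_norm hG hGs,
    dilPairing, circleAverage_def, intervalIntegral.integral_of_le two_pi_pos.le]
  simp only [tsum_mul_right, μ]

lemma continuous_pairing_weakStar {f : ℂ → ℂ} (hf : CircleIntegrable f 0 1) :
    @Continuous Hinf ℂ weakStarHinf inferInstance (pairing f) :=
  continuous_iInf_dom (i := ⟨f, hf⟩) continuous_induced_dom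

lemma continuous_interpMap_weakStar (b : ℕ → UDisc) :
    @Continuous Hinf SeqInf weakStarHinf weakStarSeq (interpMap b) := by
  refine continuous_iInf_rng.2 fun a => continuous_induced_rng.2 ?_
  obtain ⟨f, hf, hfa⟩ := exists_pairing_eq_tsum b a
  rw [show ((fun c : SeqInf => ∑' n, a n * c n) ∘ interpMap b) = pairing f from
    funext fun h => (hfa h).symm]
  exact continuous_pairing_weakStar hf

lemma continuous_val_weakStar (z : UDisc) :
    @Continuous Hinf ℂ weakStarHinf inferInstance fun h => h.val z := by
  -- A single evaluation is the case of a constant sequence of points and the coefficient sequence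
  -- `ε_0`.
  obtain ⟨f, hf, hfa⟩ := exists_pairing_eq_tsum (fun _ => z) (lp.single 1 0 1)
  rw [show (fun h : Hinf => h.val z) = pairing f from funext fun h => ?_]
  · exact continuous_pairing_weakStar hf
  · rw [hfa, tsum_eq_single 0]
    · simp
    · intro n hn
      simp [Pi.single_eq_of_ne hn]

lemma tendsto_weakStar_of_bounded {ι : Type*} {l : Filter ι} [l.IsCountablyGenerated]
    {F : ι → Hinf} {h : Hinf} {C : ℝ} (hF : ∀ i, ‖F i‖ ≤ C)
    (hlim : ∀ z, Tendsto (fun i => (F i).val z) l (𝓝 (h.val z))) :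
    Tendsto F l (@nhds Hinf weakStarHinf h) := by
  simp only [nhds_iInf, nhds_induced, tendsto_iInf, tendsto_comap_iff]
  exact fun f => tendsto_pairing hF hlim f.2

/-! ### Functionals on `ℓ^∞` and bases of `ℓ^1` -/

lemma SeqInf.norm_apply_le (c : SeqInf) (n : ℕ) : ‖c n‖ ≤ ‖c‖ :=
  lp.norm_apply_le_norm ENNReal.top_ne_zero c n

/-- The map `𝒥`, as a bounded linear map. -/
def interpCLM (b : ℕ → UDisc) : Hinf →L[ℂ] SeqInf :=
  LinearMap.mkContinuous
    { toFun := interpMap b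
      map_add' := fun _ _ => rfl
      map_smul' := fun _ _ => rfl } 1 fun h => by
    rw [one_mul]
    exact lp.norm_le_of_forall_le (norm_nonneg _) fun n => h.norm_val_le (b n)

@[simp] lemma interpMap_apply (b : ℕ → UDisc) (h : Hinf) (n : ℕ) :
    interpMap b h n = h.val (b n) := rfl

lemma norm_interpCLM_le (b : ℕ → UDisc) : ‖interpCLM b‖ ≤ 1 :=
  LinearMap.mkContinuous_norm_le _ zero_le_one _

/-- A finite sum of multiples of unit sequences is a truncation. -/
lemma lp_sum_single_apply {p : ℝ≥0∞} (s : Finset ℕ) (c : ℕ → ℂ) (m : ℕ) :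
    (∑ n ∈ s, lp.single (E := fun _ : ℕ => ℂ) p n (c n)) m = if m ∈ s then c m else 0 := by
  rw [lp.coeFn_sum, Finset.sum_apply]
  simp [Pi.single_apply]

lemma lp_single_eq_smul {p : ℝ≥0∞} (n : ℕ) (c : ℂ) :
    lp.single (E := fun _ : ℕ => ℂ) p n c = c • lp.single p n (1 : ℂ) := by
  rw [← lp.single_smul, smul_eq_mul, mul_one]

/-- A bounded functional on `ℓ^∞` which is the sum of its values on the unit sequences is given by
a summable sequence. -/
lemma exists_seq1_of_tendsto (ψ : SeqInf →L[ℂ] ℂ)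
    (hψ : ∀ c : SeqInf, Tendsto (fun N => ∑ n ∈ Finset.range N, c n * ψ (lp.single ∞ n 1)) atTop
      (𝓝 (ψ c))) :
    ∃ a : Seq1, (∀ n, a n = ψ (lp.single ∞ n 1)) ∧ ‖a‖ ≤ ‖ψ‖ ∧ ∀ c : SeqInf, ψ c = ∑' n, a n * c n := by
  set x : ℕ → ℂ := fun n => ψ (lp.single ∞ n 1)
  have hbound : ∀ s : Finset ℕ, ∑ n ∈ s, ‖x n‖ ≤ ‖ψ‖ := fun s => by
    -- Conjugate phases turn `ψ` of a finite sequence into `∑ ‖x n‖`. Where `x n = 0`, division by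
    -- zero makes `u n = 0`.
    set u : ℕ → ℂ := fun n => (starRingEnd ℂ) (x n) / ‖x n‖
    have hu : ∀ n, ‖u n‖ ≤ 1 := fun n => by
      simp only [u, norm_div, RCLike.norm_conj, Complex.norm_real, norm_norm]
      exact div_self_le_one _
    have hux : ∀ n, u n * x n = (‖x n‖ : ℂ) := fun n => by
      rcases eq_or_ne (x n) 0 with h | h
      · simp [h]
      · have : (‖x n‖ : ℂ) ≠ 0 := by simpa using h
        simp only [u, div_mul_eq_mul_div, Complex.conj_mul']
        field_simp
    set w : SeqInf := ∑ n ∈ s, lp.single ∞ n (u n)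
    have hw : ‖w‖ ≤ 1 := lp.norm_le_of_forall_le zero_le_one fun m => by
      rw [lp_sum_single_apply]
      split_ifs
      · exact hu m
      · simp
    have hψw : ψ w = ((∑ n ∈ s, ‖x n‖ : ℝ) : ℂ) := by
      simp only [w, map_sum]
      rw [Complex.ofReal_sum]
      refine Finset.sum_congr rfl fun n _ => ?_
      rw [lp_single_eq_smul, map_smul, smul_eq_mul]
      exact hux n
    have h1 := ψ.le_of_opNorm_le_of_le le_rfl hw
    rw [hψw, Complex.norm_real, mul_one] at h1
    exact (le_abs_self _).trans h1
  have hmem : Memℓp x 1 := memℓp_gen' (C := ‖ψ‖) fun s => by simpa using hbound s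
  refine ⟨⟨x, hmem⟩, fun n => rfl, ?_, fun c => ?_⟩
  · rw [Seq1.norm_eq_tsum]
    exact Real.tsum_le_of_sum_le (fun n => norm_nonneg _) hbound
  · refine tendsto_nhds_unique (hψ c) ?_
    have := (Seq1.summable_mul (⟨x, hmem⟩ : Seq1) (SeqInf.norm_apply_le c)).hasSum.tendsto_sum_nat
    simpa only [mul_comm] using this

/-- The image of the unit vector basis of `ℓ^1` under a linear homeomorphism is an
`ℓ^1`-basis. -/
lemma isSeq1Basis_of_equiv {X : Type*} [NormedAddCommGroup X] [NormedSpace ℂ X] (A : Seq1 ≃L[ℂ] X) :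
    IsSeq1Basis fun n => A (lp.single 1 n 1) := by
  refine ⟨⟨{
    basis := fun n => A (lp.single 1 n 1)
    coord := fun n => (lp.evalCLM ℂ (fun _ : ℕ => ℂ) 1 n).comp (A.symm : X →L[ℂ] Seq1)
    ortho := fun i j => ?_
    expansion := fun x => ?_ }, rfl⟩, A, fun n => rfl⟩
  · simp [lp.evalCLM, Pi.single_apply]
  · have h1 := (lp.hasSum_single (by simp) (A.symm x)).mapL (A : Seq1 →L[ℂ] X)
    have h2 : HasSum (fun n => A.symm x n • A (lp.single 1 n 1)) x := by
      simpa [lp_single_eq_smul (p := 1) _ (A.symm x _)] using h1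
    -- The expansion converges unconditionally, hence along the finer filter in the definition of a
    -- Schauder basis.
    refine h2.mono_left ?_
    exact SummationFilter.LeAtTop.le_atTop

/-! ### The synthesis operator of a Beurling system -/

/-- `S` is the operator `c ↦ ∑ c_n β_n`, the series converging absolutely on the disc. -/
def IsSynthesis (β : ℕ → Hinf) (S : SeqInf →L[ℂ] Hinf) : Prop :=
  ∀ (c : SeqInf) (z : UDisc), HasSum (fun n => c n * (β n).val z) ((S c).val z)

lemma IsSynthesis.apply_single {β : ℕ → Hinf} {S : SeqInf →L[ℂ] Hinf} (hS : IsSynthesis β S) (n : ℕ) :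
    S (lp.single ∞ n 1) = β n := by
  ext z
  refine (hS _ z).unique ?_
  convert! hasSum_single n (f := fun m => lp.single (E := fun _ : ℕ => ℂ) ∞ n 1 m * (β m).val z) ?_
    using 1
  · simp
  · intro m hm
    simp [Pi.single_eq_of_ne hm]

namespace IsBeurlingSystem

variable {b : ℕ → UDisc} {β : ℕ → Hinf} {M : ℝ}

lemma bound_nonneg (hβ : IsBeurlingSystem b β M) : 0 ≤ M :=
  (tsum_nonneg fun _ => norm_nonneg _).trans (hβ.2 (b 0)).2

lemma summable (hβ : IsBeurlingSystem b β M) (c : SeqInf) (z : UDisc) :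
    Summable (fun n => c n * (β n).val z) := by
  refine Summable.of_norm_bounded ((hβ.2 z).1.mul_left ‖c‖) fun n => ?_
  rw [norm_mul]
  exact mul_le_mul_of_nonneg_right (c.norm_apply_le n) (norm_nonneg _)

/-- This uniform bound on partial sums is what upgrades pointwise convergence of the series to weak*
convergence. -/
lemma norm_sum_le (hβ : IsBeurlingSystem b β M) (c : SeqInf) (s : Finset ℕ) :
    ‖∑ n ∈ s, c n • β n‖ ≤ M * ‖c‖ := by
  refine Hinf.norm_le (mul_nonneg hβ.bound_nonneg (norm_nonneg _)) fun z => ?_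
  rw [Hinf.val_sum]
  calc ‖∑ n ∈ s, (c n • β n).val z‖ ≤ ∑ n ∈ s, ‖(β n).val z‖ * ‖c‖ := by
        refine norm_sum_le_of_le s fun n _ => ?_
        rw [Hinf.val_smul, norm_mul, mul_comm]
        exact mul_le_mul_of_nonneg_left (c.norm_apply_le n) (norm_nonneg _)
    _ ≤ M * ‖c‖ := by
        rw [← Finset.sum_mul]
        refine mul_le_mul_of_nonneg_right ?_ (norm_nonneg _)
        exact ((hβ.2 z).1.sum_le_tsum s fun _ _ => norm_nonneg _).trans (hβ.2 z).2

lemma exists_synthesis (hβ : IsBeurlingSystem b β M) :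
    ∃ S : SeqInf →L[ℂ] Hinf, ‖S‖ ≤ M ∧ IsSynthesis β S := by
  have h1 : ∀ c : SeqInf, ∃ h : Hinf, (∀ z, h.val z = ∑' n, c n * (β n).val z) ∧ ‖h‖ ≤ M * ‖c‖ :=
    fun c => Hinf.exists_val_eq_of_tendsto (l := atTop)
      (F := fun N => ∑ n ∈ Finset.range N, c n • β n) (fun N => hβ.norm_sum_le c _) fun z => by
        simpa using (hβ.summable c z).hasSum.tendsto_sum_nat
  choose S hS hSn using h1
  have hsum : ∀ c z, HasSum (fun n => c n * (β n).val z) ((S c).val z) := fun c z => by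
    rw [hS]; exact (hβ.summable c z).hasSum
  refine ⟨LinearMap.mkContinuous { toFun := S, map_add' := ?_, map_smul' := ?_ } M hSn,
    LinearMap.mkContinuous_norm_le _ hβ.bound_nonneg _, hsum⟩
  · intro c d
    ext z
    refine (hsum (c + d) z).unique ?_
    simpa [add_mul] using (hsum c z).add (hsum d z)
  · intro k c
    ext z
    refine (hsum (k • c) z).unique ?_
    simpa [mul_assoc] using (hsum c z).mul_left k

end IsBeurlingSystem

/-! ### The range of the synthesis operator, its predual and the two bases -/

lemma continuous_interpMap_weakStarOn (b : ℕ → UDisc) (E : Submodule ℂ Hinf) :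
    @Continuous E SeqInf (weakStarOn E) weakStarSeq fun h => interpMap b h :=
  @Continuous.comp _ _ _ (weakStarOn E) weakStarHinf weakStarSeq _ _
    (continuous_interpMap_weakStar b) continuous_induced_dom

lemma norm_tsum_mul_val_le (b : ℕ → UDisc) (a : Seq1) (h : Hinf) :
    ‖∑' n, a n * h.val (b n)‖ ≤ ‖a‖ * ‖h‖ := by
  rw [Seq1.norm_eq_tsum, ← tsum_mul_right]
  refine tsum_of_norm_bounded (a.summable_norm.mul_right _).hasSum fun n => ?_
  rw [norm_mul]
  exact mul_le_mul_of_nonneg_left (h.norm_val_le _) (norm_nonneg _)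

/-- The functional `h ↦ ∑ a_n h(b_n)` on `E`, for `a ∈ ℓ^1`, depending linearly on `a`. -/
def evalSeries (b : ℕ → UDisc) (E : Submodule ℂ Hinf) : Seq1 →ₗ[ℂ] Predual E where
  toFun a :=
    (⟨LinearMap.mkContinuous
      { toFun := fun h : E => ∑' n, a n * (h : Hinf).val (b n)
        map_add' := fun g h => by
          rw [← (a.summable_mul fun n => (g : Hinf).norm_val_le (b n)).tsum_add
            (a.summable_mul fun n => (h : Hinf).norm_val_le (b n))]
          simp [mul_add]
        map_smul' := fun c h => by
          simp [← tsum_mul_left, mul_left_comm] } ‖a‖ fun h =>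
        norm_tsum_mul_val_le b a h, by
      obtain ⟨f, hf, hfa⟩ := exists_pairing_eq_tsum b a
      change @Continuous E ℂ (weakStarHinf.induced Subtype.val) inferInstance
        fun h : E => ∑' n, a n * (h : Hinf).val (b n)
      simp only [← hfa]
      exact @Continuous.comp _ _ _ (weakStarOn E) weakStarHinf _ _ _
        (continuous_pairing_weakStar hf) continuous_induced_dom⟩ :
      predualSubmodule E Subtype.val)
  map_add' a a' := by
    refine Subtype.ext (ContinuousLinearMap.ext fun h => ?_)
    change ∑' n, (a n + a' n) * (h : Hinf).val (b n) =
      ∑' n, a n * (h : Hinf).val (b n) + ∑' n, a' n * (h : Hinf).val (b n)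
    rw [← (a.summable_mul fun n => (h : Hinf).norm_val_le (b n)).tsum_add
      (a'.summable_mul fun n => (h : Hinf).norm_val_le (b n))]
    simp [add_mul]
  map_smul' c a := by
    refine Subtype.ext (ContinuousLinearMap.ext fun h => ?_)
    change ∑' n, (c * a n) * (h : Hinf).val (b n) = c * ∑' n, a n * (h : Hinf).val (b n)
    simp [← tsum_mul_left, mul_assoc]

lemma evalSeries_apply (b : ℕ → UDisc) (E : Submodule ℂ Hinf) (a : Seq1) (h : E) :
    Predual.apply (evalSeries b E a) h = ∑' n, a n * (h : Hinf).val (b n) := rfl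

lemma norm_evalSeries_le (b : ℕ → UDisc) (E : Submodule ℂ Hinf) (a : Seq1) :
    ‖evalSeries b E a‖ ≤ ‖a‖ :=
  ContinuousLinearMap.opNorm_le_bound (evalSeries b E a).toDual (norm_nonneg _) fun h =>
    norm_tsum_mul_val_le b a h

lemma evalSeries_single (b : ℕ → UDisc) (E : Submodule ℂ Hinf) (n : ℕ) (h : E) :
    Predual.apply (evalSeries b E (lp.single 1 n 1)) h = (h : Hinf).val (b n) := by
  rw [evalSeries_apply, tsum_eq_single n]
  · simp
  · intro m hm
    simp [Pi.single_eq_of_ne hm]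

lemma Predual.ext {E : Submodule ℂ Hinf} {L L' : Predual E}
    (H : ∀ h, Predual.apply L h = Predual.apply L' h) : L = L' :=
  Subtype.ext (ContinuousLinearMap.ext H)

lemma Predual.continuous_apply {E : Submodule ℂ Hinf} (L : Predual E) :
    @Continuous E ℂ (weakStarOn E) inferInstance (Predual.apply L) :=
  Subtype.prop (p := (· ∈ predualSubmodule E Subtype.val)) L

namespace IsBeurlingSystem

variable {b : ℕ → UDisc} {β : ℕ → Hinf} {M : ℝ} {S : SeqInf →L[ℂ] Hinf}

lemma interpMap_synthesis (hβ : IsBeurlingSystem b β M)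
    (hS : IsSynthesis β S) (c : SeqInf) :
    interpMap b (S c) = c := by
  ext j
  refine (hS c (b j)).unique ?_
  convert! hasSum_single j (f := fun n => c n * (β n).val (b j)) ?_ using 1
  · simp [hβ.1 j j]
  · intro n hn
    simp [hβ.1 n j, hn]

lemma tendsto_synthesis (hβ : IsBeurlingSystem b β M)
    (hS : IsSynthesis β S) (c : SeqInf) :
    Tendsto (fun N => ∑ n ∈ Finset.range N, c n • β n) atTop (@nhds Hinf weakStarHinf (S c)) :=
  tendsto_weakStar_of_bounded (fun N => hβ.norm_sum_le c _) fun z => by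
    simpa using (hS c z).tendsto_sum_nat

/-- Each `⟨f, S c⟩` equals `∑ c_n ⟨f, β_n⟩` by weak* convergence of the partial sums, and the
coefficients are summable, so it is one of the functionals defining the topology of `ℓ^∞`. -/
lemma continuous_synthesis_weakStar (hβ : IsBeurlingSystem b β M)
    (hS : IsSynthesis β S) :
    @Continuous SeqInf Hinf weakStarSeq weakStarHinf S := by
  refine continuous_iInf_rng.2 fun f => continuous_induced_rng.2 ?_
  obtain ⟨a, -, -, ha⟩ := exists_seq1_of_tendsto ((pairingCLM f.2).comp S) fun c => by
    have h1 := (@Continuous.tendsto _ _ weakStarHinf _ _ (continuous_pairing_weakStar f.2)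
      (S c)).comp (hβ.tendsto_synthesis hS c)
    refine h1.congr fun N => ?_
    change pairingCLM f.2 (∑ n ∈ Finset.range N, c n • β n) = _
    rw [map_sum]
    refine Finset.sum_congr rfl fun n _ => ?_
    rw [map_smul, ContinuousLinearMap.comp_apply, hS.apply_single, smul_eq_mul]
  rw [show (pairing f.1 ∘ S) = fun c : SeqInf => ∑' n, a n * c n from funext ha]
  exact continuous_iInf_dom (i := a) continuous_induced_dom

/-- The range is the fixed-point set of the weak*-continuous map `S 𝒥`. Testing at points of the
disc turns this into equalities of continuous scalar functions, so no separation property of the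
weak* topology is needed. -/
lemma isClosed_range_synthesis (hβ : IsBeurlingSystem b β M)
    (hS : IsSynthesis β S) :
    @IsClosed Hinf weakStarHinf (LinearMap.range (S : SeqInf →ₗ[ℂ] Hinf) : Set Hinf) := by
  have hset : (LinearMap.range (S : SeqInf →ₗ[ℂ] Hinf) : Set Hinf) =
      ⋂ z : UDisc, {h | h.val z = (S (interpMap b h)).val z} := by
    ext h
    rw [Set.mem_iInter]
    constructor
    · rintro ⟨c, rfl⟩ z
      change (S c).val z = (S (interpMap b (S c))).val z
      rw [hβ.interpMap_synthesis hS]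
    · exact fun H => ⟨interpMap b h, (Hinf.ext H).symm⟩
  rw [hset]
  refine @isClosed_iInter Hinf _ weakStarHinf _ fun z => ?_
  refine @isClosed_eq ℂ Hinf _ weakStarHinf _ _ _ (continuous_val_weakStar z) ?_
  have h1 := @Continuous.comp _ _ _ weakStarHinf weakStarSeq weakStarHinf _ _
    (hβ.continuous_synthesis_weakStar hS) (continuous_interpMap_weakStar b)
  exact @Continuous.comp _ _ _ weakStarHinf weakStarHinf _ _ _ (continuous_val_weakStar z) h1

/-- The synthesis operator as a linear homeomorphism onto its range. -/
def synthesisEquiv (hβ : IsBeurlingSystem b β M)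
    (hS : IsSynthesis β S) :
    SeqInf ≃L[ℂ] LinearMap.range (S : SeqInf →ₗ[ℂ] Hinf) :=
  ContinuousLinearEquiv.equivOfInverse
    (S.codRestrict _ fun c => LinearMap.mem_range_self (S : SeqInf →ₗ[ℂ] Hinf) c)
    ((interpCLM b).comp (Submodule.subtypeL _)) (hβ.interpMap_synthesis hS) (by
      rintro ⟨_, c, rfl⟩
      refine Subtype.ext ?_
      change S (interpMap b (S c)) = S c
      rw [hβ.interpMap_synthesis hS])

/-- The coefficients are `a_n = L(β_n)`: the functional `L ∘ S` on `ℓ^∞` is the sum of its values on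
the unit sequences, and `c_n` is the value of `S c` at `b_n`. -/
lemma exists_evalSeries_eq (hβ : IsBeurlingSystem b β M) (hSM : ‖S‖ ≤ M)
    (hS : IsSynthesis β S)
    (L : Predual (LinearMap.range (S : SeqInf →ₗ[ℂ] Hinf))) :
    ∃ a : Seq1, ‖a‖ ≤ M * ‖L‖ ∧ evalSeries b _ a = L := by
  set T := hβ.synthesisEquiv hS
  have hT : ∀ c, ((T c : LinearMap.range (S : SeqInf →ₗ[ℂ] Hinf)) : Hinf) = S c := fun _ => rfl
  have hTM : ‖(T : SeqInf →L[ℂ] LinearMap.range (S : SeqInf →ₗ[ℂ] Hinf))‖ ≤ M :=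
    ContinuousLinearMap.opNorm_le_bound _ hβ.bound_nonneg fun c => S.le_of_opNorm_le hSM c
  obtain ⟨a, -, han, ha⟩ := exists_seq1_of_tendsto (L.toDual.comp (T : SeqInf →L[ℂ] _)) fun c => by
    have h1 : Tendsto (fun N => ∑ n ∈ Finset.range N, c n • T (lp.single ∞ n 1)) atTop
        (@nhds _ (weakStarOn _) (T c)) := by
      rw [@nhds_induced _ _ weakStarHinf, tendsto_comap_iff]
      refine (hβ.tendsto_synthesis hS c).congr fun N => ?_
      simp [hT, hS.apply_single]
    refine ((@Continuous.tendsto _ _ (weakStarOn _) _ _ L.continuous_apply _).comp h1).congr fun N => ?_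
    simp [Predual.apply]
  refine ⟨a, han.trans ?_, Predual.ext fun h => ?_⟩
  · refine (ContinuousLinearMap.opNorm_comp_le _ _).trans ?_
    rw [mul_comm]
    exact mul_le_mul_of_nonneg_right hTM (norm_nonneg _)
  · obtain ⟨c, rfl⟩ := T.surjective h
    rw [evalSeries_apply]
    refine Eq.trans ?_ (ha c).symm
    refine tsum_congr fun n => ?_
    rw [hT, ← interpMap_apply, hβ.interpMap_synthesis hS]

lemma injective_evalSeries (hβ : IsBeurlingSystem b β M)
    (hS : IsSynthesis β S) :
    Function.Injective (evalSeries b (LinearMap.range (S : SeqInf →ₗ[ℂ] Hinf))) := by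
  intro a a' h
  ext n
  have key : ∀ x : Seq1, Predual.apply (evalSeries b _ x)
      (hβ.synthesisEquiv hS (lp.single ∞ n 1)) = x n := fun x => by
    rw [evalSeries_apply, tsum_eq_single n]
    · change x n * (S (lp.single ∞ n 1)).val (b n) = x n
      rw [hS.apply_single, hβ.1]
      simp
    · intro m hm
      change x m * (S (lp.single ∞ n 1)).val (b m) = 0
      rw [hS.apply_single, hβ.1, if_neg hm.symm, mul_zero]
  rw [← key a, ← key a', h]

/-- The identification of `ℓ^1` with the predual of the range of the synthesis operator. -/
def predualEquiv (hβ : IsBeurlingSystem b β M) (hSM : ‖S‖ ≤ M)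
    (hS : IsSynthesis β S) :
    Seq1 ≃L[ℂ] Predual (LinearMap.range (S : SeqInf →ₗ[ℂ] Hinf)) :=
  (LinearEquiv.ofBijective (evalSeries b _) ⟨hβ.injective_evalSeries hS, fun L =>
    (hβ.exists_evalSeries_eq hSM hS L).imp fun _ h => h.2⟩).toContinuousLinearEquivOfBounds 1 M
    (fun a => by rw [one_mul]; exact norm_evalSeries_le b _ a) fun L => by
      obtain ⟨a, ha, rfl⟩ := hβ.exists_evalSeries_eq hSM hS L
      rwa [← LinearEquiv.ofBijective_apply (evalSeries b _) (hf := ⟨hβ.injective_evalSeries hS,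
        fun L => (hβ.exists_evalSeries_eq hSM hS L).imp fun _ h => h.2⟩) (x := a),
        LinearEquiv.symm_apply_apply]

lemma continuous_synthesisEquiv_weakStar (hβ : IsBeurlingSystem b β M)
    (hS : IsSynthesis β S) :
    @Continuous SeqInf (LinearMap.range (S : SeqInf →ₗ[ℂ] Hinf)) weakStarSeq (weakStarOn _)
      ⇑(hβ.synthesisEquiv hS) := by
  refine continuous_induced_rng.2 ?_
  exact hβ.continuous_synthesis_weakStar hS

lemma continuous_synthesisEquiv_symm_weakStar (hβ : IsBeurlingSystem b β M)
    (hS : IsSynthesis β S) :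
    @Continuous (LinearMap.range (S : SeqInf →ₗ[ℂ] Hinf)) SeqInf (weakStarOn _) weakStarSeq
      ⇑(hβ.synthesisEquiv hS).symm := by
  rw [show ⇑(hβ.synthesisEquiv hS).symm =
    fun h : LinearMap.range (S : SeqInf →ₗ[ℂ] Hinf) => interpMap b h from rfl]
  exact continuous_interpMap_weakStarOn b _

lemma isWeakStarHomeo_synthesisEquiv (hβ : IsBeurlingSystem b β M)
    (hS : IsSynthesis β S) :
    IsWeakStarHomeo ⇑(hβ.synthesisEquiv hS) ⇑(hβ.synthesisEquiv hS).symm :=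
  ⟨(hβ.synthesisEquiv hS).left_inv, (hβ.synthesisEquiv hS).right_inv,
    hβ.continuous_synthesisEquiv_weakStar hS, hβ.continuous_synthesisEquiv_symm_weakStar hS⟩

lemma isSeqInfBasis (hβ : IsBeurlingSystem b β M) (hSM : ‖S‖ ≤ M)
    (hS : IsSynthesis β S)
    (hmem : ∀ n, β n ∈ LinearMap.range (S : SeqInf →ₗ[ℂ] Hinf)) :
    IsSeqInfBasis fun n => (⟨β n, hmem n⟩ : LinearMap.range (S : SeqInf →ₗ[ℂ] Hinf)) := by
  refine ⟨fun y => ⟨fun n => (y : Hinf).val (b n), fun L => ?_, fun α hα => ?_⟩,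
    (hβ.synthesisEquiv hS).toLinearEquiv, hβ.isWeakStarHomeo_synthesisEquiv hS, fun n =>
      Subtype.ext (hS.apply_single n)⟩
  · obtain ⟨a, -, rfl⟩ := hβ.exists_evalSeries_eq hSM hS L
    have h1 : ∀ n, Predual.apply (evalSeries b _ a)
        (⟨β n, hmem n⟩ : LinearMap.range (S : SeqInf →ₗ[ℂ] Hinf)) = a n := fun n => by
      rw [evalSeries_apply, tsum_eq_single n]
      · simp [hβ.1]
      · intro m hm
        simp [hβ.1, hm.symm]
    simp only [h1]
    rw [evalSeries_apply]
    have h2 := (a.summable_mul fun n => (y : Hinf).norm_val_le (b n)).hasSum.tendsto_sum_nat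
    simpa only [mul_comm] using h2
  · funext m
    -- Uniqueness: evaluation at `b m` makes the partial sums equal to `α m` as soon as `N > m`.
    have h1 := hα (evalSeries b _ (lp.single 1 m 1))
    simp only [evalSeries_single, hβ.1] at h1
    refine (tendsto_nhds_unique h1 ?_).symm
    refine tendsto_const_nhds.congr' ?_
    filter_upwards [eventually_gt_atTop m] with N hN
    simp [hN]

end IsBeurlingSystem

/-! ### Existence of Beurling functions: finite Fourier transform and compactness -/

/-- The square of a bounded holomorphic function. -/
def Hinf.sq (h : Hinf) : Hinf :=
  Hinf.mk (fun z => h.val z ^ 2)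
    ((h.differentiableOn.pow 2).congr fun z hz => by
      simp [discExt_of_mem _ hz]) (‖h‖ ^ 2) fun z => by
    rw [norm_pow]
    exact pow_le_pow_left₀ (norm_nonneg _) (h.norm_val_le z) 2

@[simp] lemma Hinf.sq_val (h : Hinf) (z : UDisc) : h.sq.val z = h.val z ^ 2 := rfl

lemma norm_stdAddChar {N : ℕ} [NeZero N] (x : ZMod N) : ‖ZMod.stdAddChar x‖ = 1 := by
  rw [ZMod.stdAddChar_apply, Circle.norm_coe]

lemma sum_stdAddChar_mul {N : ℕ} [NeZero N] (x : ZMod N) :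
    ∑ j : ZMod N, ZMod.stdAddChar (j * x) = if x = 0 then (N : ℂ) else 0 := by
  rw [AddChar.sum_mulShift x (ZMod.isPrimitive_stdAddChar N), ZMod.card]
  split_ifs <;> simp

/-- Parseval's identity for the finite Fourier transform. -/
lemma sum_norm_sq_sum_stdAddChar {N : ℕ} [NeZero N] (f : ZMod N → ℂ) :
    ∑ k : ZMod N, ‖∑ j, ZMod.stdAddChar (-(j * k)) * f j‖ ^ 2 = N * ∑ j, ‖f j‖ ^ 2 := by
  have h1 : ∀ x : ℂ, ((‖x‖ ^ 2 : ℝ) : ℂ) = x * (starRingEnd ℂ) x := fun x => by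
    rw [Complex.mul_conj']; push_cast; rfl
  have h2 : ∀ x : ZMod N, (starRingEnd ℂ) (ZMod.stdAddChar x) = ZMod.stdAddChar (-x) := fun x =>
    (AddChar.map_neg_eq_conj _ x).symm
  apply Complex.ofReal_injective
  push_cast
  simp only [← Complex.ofReal_pow, h1, map_sum, map_mul, h2, Finset.sum_mul_sum, neg_neg]
  rw [Finset.sum_comm, Finset.mul_sum]
  refine Finset.sum_congr rfl fun j _ => ?_
  rw [Finset.sum_comm]
  have h3 : ∀ i, ∑ k : ZMod N, ZMod.stdAddChar (-(j * k)) * f j *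
      (ZMod.stdAddChar (i * k) * (starRingEnd ℂ) (f i)) =
      if i - j = 0 then N * (f j * (starRingEnd ℂ) (f i)) else 0 := fun i => by
    have h4 : ∀ k : ZMod N, ZMod.stdAddChar (-(j * k)) * f j *
        (ZMod.stdAddChar (i * k) * (starRingEnd ℂ) (f i)) =
        ZMod.stdAddChar (k * (i - j)) * (f j * (starRingEnd ℂ) (f i)) := fun k => by
      rw [show k * (i - j) = -(j * k) + i * k by ring, AddChar.map_add_eq_mul]
      ring
    simp only [h4]
    rw [← Finset.sum_mul, sum_stdAddChar_mul, ite_mul, zero_mul]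
  simp only [h3, sub_eq_zero]
  simp

/-- A finite version of the Beurling functions, from averaging over the characters of `ℤ/N`. -/
lemma exists_finite_beurlingSystem {b : ℕ → UDisc} {C : ℝ} (hC : 0 ≤ C)
    (hint : ∀ c : SeqInf, ∃ h : Hinf, interpMap b h = c ∧ ‖h‖ ≤ C * ‖c‖) (N : ℕ) [NeZero N] :
    ∃ β : ℕ → Hinf, (∀ k < N, ∀ j < N, (β k).val (b j) = if k = j then 1 else 0) ∧
      (∀ k, ‖β k‖ ≤ C ^ 2) ∧ ∀ z, ∑ k ∈ Finset.range N, ‖(β k).val z‖ ≤ C ^ 2 := by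
  have hN : (N : ℂ) ≠ 0 := NeZero.ne _
  have hc : ∀ j : ZMod N, ∃ h : Hinf, (∀ n, h.val (b n) = ZMod.stdAddChar (j * (n : ZMod N))) ∧
      ‖h‖ ≤ C := fun j => by
    set c : SeqInf := ⟨fun n => ZMod.stdAddChar (j * (n : ZMod N)), memℓp_infty ⟨1, by
      rintro _ ⟨n, rfl⟩
      exact (norm_stdAddChar _).le⟩⟩
    have hcn : ‖c‖ ≤ 1 := lp.norm_le_of_forall_le zero_le_one fun n => (norm_stdAddChar _).le
    obtain ⟨h, hh, hn⟩ := hint c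
    refine ⟨h, fun n => ?_, hn.trans (mul_le_of_le_one_right hC hcn)⟩
    rw [← interpMap_apply, hh]
  choose f hf hfn using hc
  -- Orthogonality of characters gives `g k` the value `δ_{kj}` at `b j`, and squaring preserves the
  -- values `0` and `1` while turning the `ℓ^2` bound of Parseval into an `ℓ^1` bound.
  set g : ZMod N → Hinf := fun k => (N : ℂ)⁻¹ • ∑ j, ZMod.stdAddChar (-(j * k)) • f j
  have hg : ∀ k z, (g k).val z = (N : ℂ)⁻¹ * ∑ j, ZMod.stdAddChar (-(j * k)) * (f j).val z :=
    fun k z => by simp [g]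
  have hsq : ∀ z, ∑ k, ‖(g k).sq.val z‖ ≤ C ^ 2 := fun z => by
    have hN0 : (0 : ℝ) < N := Nat.cast_pos.2 (NeZero.pos N)
    simp only [Hinf.sq_val, hg, norm_pow, norm_mul, mul_pow, ← Finset.mul_sum]
    rw [sum_norm_sq_sum_stdAddChar fun j => (f j).val z, norm_inv, Complex.norm_natCast]
    have h1 : ∑ j, ‖(f j).val z‖ ^ 2 ≤ N * C ^ 2 := by
      refine (Finset.sum_le_card_nsmul _ _ (C ^ 2) fun j _ => ?_).trans_eq ?_
      · exact pow_le_pow_left₀ (norm_nonneg _) (((f j).norm_val_le z).trans (hfn j)) 2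
      · simp [ZMod.card]
    calc (N : ℝ)⁻¹ ^ 2 * (N * ∑ j, ‖(f j).val z‖ ^ 2) ≤ (N : ℝ)⁻¹ ^ 2 * (N * (N * C ^ 2)) := by
          gcongr
      _ = C ^ 2 := by field_simp
  -- The index is read modulo `N`, so the norm bound holds for every `k`, but the interpolation only
  -- for `k, j < N`.
  refine ⟨fun k => (g k).sq, fun k hk j hj => ?_, fun k => ?_, fun z => ?_⟩
  · have h1 : (g k).val (b j) = if k = j then 1 else 0 := by
      rw [hg]
      have h2 : ∀ i : ZMod N, ZMod.stdAddChar (-(i * (k : ZMod N))) * (f i).val (b j) =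
          ZMod.stdAddChar (i * ((j : ZMod N) - (k : ZMod N))) := fun i => by
        rw [hf, ← AddChar.map_add_eq_mul]
        congr 1
        ring
      simp only [h2]
      have h3 : (j : ZMod N) - k = 0 ↔ j = k := by
        rw [sub_eq_zero, ZMod.natCast_eq_natCast_iff, Nat.ModEq, Nat.mod_eq_of_lt hj,
          Nat.mod_eq_of_lt hk]
      simp only [sum_stdAddChar_mul, h3]
      rcases eq_or_ne k j with h | h
      · simp [h, hN]
      · simp [h, h.symm]
    rw [Hinf.sq_val, h1]
    split_ifs <;> simp
  · refine Hinf.norm_le (sq_nonneg C) fun z => (le_trans ?_ (hsq z))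
    exact Finset.single_le_sum (f := fun k => ‖(g k).sq.val z‖) (fun _ _ => norm_nonneg _)
      (Finset.mem_univ (k : ZMod N))
  · refine le_trans ?_ (hsq z)
    have hinj : Set.InjOn (fun k : ℕ => (k : ZMod N)) (Finset.range N) := fun k hk j hj h => by
      rw [Finset.coe_range, Set.mem_Iio] at hk hj
      have := (ZMod.natCast_eq_natCast_iff _ _ _).1 h
      rwa [Nat.ModEq, Nat.mod_eq_of_lt hj, Nat.mod_eq_of_lt hk] at this
    rw [← Finset.sum_image (f := fun k : ZMod N => ‖(g k).sq.val z‖) hinj]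
    exact Finset.sum_le_sum_of_subset_of_nonneg (Finset.subset_univ _) fun _ _ _ => norm_nonneg _

lemma interpConst_nonneg (b : ℕ → UDisc) : 0 ≤ interpConst b :=
  Real.sInf_nonneg fun _ h => h.1

/-- By the open mapping theorem the set of admissible constants is nonempty, so its infimum is a
genuine one and not the default value of `sInf ∅`. -/
lemma exists_interp_of_interpConst_lt {b : ℕ → UDisc} (hb : IsInterpolating b) {C : ℝ}
    (hC : interpConst b < C) :
    ∃ D < C, 0 ≤ D ∧ ∀ c : SeqInf, ∃ h : Hinf, interpMap b h = c ∧ ‖h‖ ≤ D * ‖c‖ := by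
  obtain ⟨K, hK, hKc⟩ := (interpCLM b).exists_preimage_norm_le hb
  obtain ⟨D, hD, hDC⟩ := exists_lt_of_csInf_lt
    (s := {C : ℝ | 0 ≤ C ∧ ∀ c : SeqInf, ∃ h : Hinf, interpMap b h = c ∧ ‖h‖ ≤ C * ‖c‖})
    ⟨K, hK.le, hKc⟩ hC
  exact ⟨D, hDC, hD⟩

/-- Since the infimum is not known to be attained, the constant `M + 1 / (N + 1)` is used at stage
`N`. The bound `(M + 1) ^ 2`, free of `N`, provides the compactness. -/
lemma exists_isBeurlingSystem {b : ℕ → UDisc} (hb : IsInterpolating b) :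
    ∃ β : ℕ → Hinf, IsBeurlingSystem b β (interpConst b ^ 2) := by
  set M := interpConst b
  have hM : 0 ≤ M := interpConst_nonneg b
  have h1 : ∀ N : ℕ, ∃ β : ℕ → Hinf,
      (∀ k < N + 1, ∀ j < N + 1, (β k).val (b j) = if k = j then 1 else 0) ∧
      (∀ k, ‖β k‖ ≤ (M + 1) ^ 2) ∧
      ∀ z, ∑ k ∈ Finset.range (N + 1), ‖(β k).val z‖ ≤ (M + 1 / ((N : ℝ) + 1)) ^ 2 := fun N => by
    have hN : (0 : ℝ) < 1 / ((N : ℝ) + 1) := by positivity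
    have hN1 : 1 / ((N : ℝ) + 1) ≤ 1 := by
      rw [div_le_one (by positivity)]
      linarith [(Nat.cast_nonneg N : (0 : ℝ) ≤ N)]
    obtain ⟨D, hDC, hD, hint⟩ := exists_interp_of_interpConst_lt hb (lt_add_of_pos_right M hN)
    obtain ⟨β, h2, h3, h4⟩ := exists_finite_beurlingSystem hD hint (N + 1)
    exact ⟨β, h2, fun k => (h3 k).trans (pow_le_pow_left₀ hD (by linarith) 2),
      fun z => (h4 z).trans (pow_le_pow_left₀ hD hDC.le 2)⟩
  choose F hδ hFn hFs using h1
  -- One ultrafilter gives limits for all `k` and `z` simultaneously, in place of a diagonal choice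
  -- of subsequences.
  set U : Ultrafilter ℕ := hyperfilter ℕ
  have hU : (U : Filter ℕ) ≤ atTop := by
    rw [← Nat.cofinite_eq_atTop]
    exact hyperfilter_le_cofinite
  have hlim : ∀ k z, ∃ y, Tendsto (fun N => (F N k).val z) U (𝓝 y) := fun k z => by
    obtain ⟨y, -, hy⟩ := (isCompact_closedBall (0 : ℂ) ((M + 1) ^ 2)).ultrafilter_le_nhds
      (U.map fun N => (F N k).val z) (by
        rw [le_principal_iff]
        refine Ultrafilter.mem_map.2 (Filter.Eventually.of_forall fun N => ?_)
        change (F N k).val z ∈ closedBall 0 _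
        rw [mem_closedBall_zero_iff]
        exact ((F N k).norm_val_le z).trans (hFn N k))
    exact ⟨y, hy⟩
  choose y hy using hlim
  have h2 : ∀ k, ∃ h : Hinf, (∀ z, h.val z = y k z) ∧ ‖h‖ ≤ (M + 1) ^ 2 := fun k =>
    Hinf.exists_val_eq_of_tendsto (fun N => hFn N k) (hy k)
  choose β hβ _ using h2
  -- Only finite sums pass to the limit directly; every finite `s` lies in `range (N + 1)` for large
  -- `N`, and the bounds tend to `M ^ 2`.
  have hsum : ∀ z (s : Finset ℕ), ∑ k ∈ s, ‖(β k).val z‖ ≤ M ^ 2 := fun z s => by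
    have h3 : Tendsto (fun N => ∑ k ∈ s, ‖(F N k).val z‖) U (𝓝 (∑ k ∈ s, ‖(β k).val z‖)) := by
      refine tendsto_finsetSum s fun k _ => ?_
      rw [hβ]
      exact (hy k z).norm
    have h4 : Tendsto (fun N : ℕ => (M + 1 / ((N : ℝ) + 1)) ^ 2) U (𝓝 (M ^ 2)) := by
      have := ((tendsto_one_div_add_atTop_nhds_zero_nat (𝕜 := ℝ)).const_add M).pow 2
      rw [add_zero] at this
      exact this.mono_left hU
    refine le_of_tendsto_of_tendsto h3 h4 ?_
    obtain ⟨K, hK⟩ := s.bddAbove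
    filter_upwards [hU (eventually_ge_atTop K)] with N hN
    refine le_trans (Finset.sum_le_sum_of_subset_of_nonneg (fun k hk => ?_)
      fun _ _ _ => norm_nonneg _) (hFs N z)
    exact Finset.mem_range.2 (Nat.lt_succ_of_le ((hK hk).trans hN))
  refine ⟨β, fun k j => ?_, fun z => ⟨?_, ?_⟩⟩
  · rw [hβ]
    refine tendsto_nhds_unique (hy k (b j)) (tendsto_const_nhds.congr' ?_)
    filter_upwards [hU (eventually_ge_atTop (max k j))] with N hN
    exact (hδ N k (Nat.lt_succ_of_le ((le_max_left _ _).trans hN)) j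
      (Nat.lt_succ_of_le ((le_max_right _ _).trans hN))).symm
  · exact summable_of_sum_le (fun _ => norm_nonneg _) (hsum z)
  · exact Real.tsum_le_of_sum_le (fun _ => norm_nonneg _) (hsum z)

end

theorem mainTheorem3 (b : ℕ → UDisc) (hb : IsInterpolating b) :
    (∀ (β : ℕ → Hinf) (M : ℝ), IsBeurlingSystem b β M →
      ∃ (E : Submodule ℂ Hinf) (T : SeqInf ≃L[ℂ] E),
        -- `T c = ∑ c_n β_n`, pointwise (absolutely) on the disc and in the weak* topology
        (∀ (c : SeqInf) (z : UDisc),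
          HasSum (fun n => c n * (β n).val z) ((T c : Hinf).val z)) ∧
        (∀ c : SeqInf, Tendsto (fun N => ∑ n ∈ Finset.range N, c n • β n) atTop
          (@nhds Hinf weakStarHinf (T c : Hinf))) ∧
        -- the norm estimates, the inverse, and the weak*-homeomorphism
        ‖(T : SeqInf →L[ℂ] E)‖ ≤ M ∧
        ‖(T.symm : E →L[ℂ] SeqInf)‖ ≤ 1 ∧
        (∀ h : E, T.symm h = interpMap b (h : Hinf)) ∧
        IsWeakStarHomeo T T.symm ∧
        @IsClosed Hinf weakStarHinf (E : Set Hinf) ∧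
        -- the evaluations at the points `b_n` form an `ℓ^1`-basis of the predual of `E`
        (∃ ev : ℕ → Predual E,
          (∀ (n : ℕ) (h : E), Predual.apply (ev n) h = (h : Hinf).val (b n)) ∧
          IsSeq1Basis ev) ∧
        -- `(β_n)` is an `ℓ^∞`-basis of `E`
        (∃ hβ : ∀ n, β n ∈ E, IsSeqInfBasis (fun n => (⟨β n, hβ n⟩ : E)))) ∧
    (∃ β : ℕ → Hinf, IsBeurlingSystem b β (interpConst b ^ 2)) := by
  refine ⟨fun β M hβ => ?_, exists_isBeurlingSystem hb⟩
  obtain ⟨S, hSM, hS⟩ := hβ.exists_synthesis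
  have hmem : ∀ n, β n ∈ LinearMap.range (S : SeqInf →ₗ[ℂ] Hinf) := fun n =>
    ⟨lp.single ∞ n 1, hS.apply_single n⟩
  refine ⟨LinearMap.range (S : SeqInf →ₗ[ℂ] Hinf), hβ.synthesisEquiv hS, hS,
    hβ.tendsto_synthesis hS, ?_, ?_, fun h => rfl, hβ.isWeakStarHomeo_synthesisEquiv hS,
    hβ.isClosed_range_synthesis hS,
    ⟨fun n => evalSeries b _ (lp.single 1 n 1), evalSeries_single b _,
      isSeq1Basis_of_equiv (hβ.predualEquiv hSM hS)⟩,
    hmem, hβ.isSeqInfBasis hSM hS hmem⟩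
  · exact ContinuousLinearMap.opNorm_le_bound _ hβ.bound_nonneg fun c => S.le_of_opNorm_le hSM c
  · exact ContinuousLinearMap.opNorm_le_bound _ zero_le_one fun h =>
      (interpCLM b).le_of_opNorm_le (norm_interpCLM_le b) h
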